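/- Let $\gamma>0$, $\mu>0$, $\omega_0:=\frac{4}{\gamma^2}$, $\omega^*:=\frac{4}{\gamma^2}\,\frac{\mu+1}{\mu}$, and let $\omega>\omega_0$. Let $H_\gamma$ be the operator in $L^2(\mathbb R)$ (complex-valued functions) with domain $$D(H_\gamma)=\{\psi\in H^2(\mathbb R\setminus\{0\}) : \psi'(0+)=\psi'(0-),\ \psi(0+)-\psi(0-)=-\gamma\,\psi'(0+)\}$$ and action $H_\gamma\psi=-\psi''$ on $\mathbb R\setminus\{0\}$. Let $$y=\frac{1}{2\mu\sqrt\omega}\log\frac{\gamma\sqrt\omega+2}{\gamma\sqrt\omega-2}$$ (equivalently $\tanh(\mu\sqrt\omega\,y)=\frac{2}{\gamma\sqrt\omega}$), and let $$L_1=H_\gamma+\omega-\frac{\omega(\mu+1)(2\mu+1)}{\cosh^2(\mu\sqrt\omega(|x|+y))},\qquad D(L_1)=D(H_\gamma),$$ the real part of the linearization, around the symmetric (odd) stationary state, of the focusing nonlinear Schrödinger equation with power nonlinearity $|\psi|^{2\mu}\psi$ and an attractive $\delta'$ interaction at the origin. Then: a) if $\omega<\omega^*$, then $L_1$ has trivial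 kernel and exactly one negative eigenvalue, which is simple; b) if $\omega=\omega^*$, then $L_1$ has a one-dimensional kernel, spanned by the function $$\xi_{-1}(x)=\frac{\sinh(\mu\sqrt\omega(|x|+y))}{\cosh^{1+\frac1\mu}(\mu\sqrt\omega(|x|+y))},$$ and exactly one negative eigenvalue, which is simple; c) if $\omega>\omega^*$, then $L_1$ has trivial kernel and either exactly two distinct negative eigenvalues, both simple, or exactly one negative eigenvalue, which is double (so exactly two negative eigenvalues, counted with multiplicity). -/

import Mathlib

open MeasureTheory Filter Topology

noncomputable section

namespace DeltaPrime

/-- The complex Hilbert space `L²(ℝ)`. -/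
abbrev L2R : Type := Lp ℂ 2 (volume : Measure ℝ)

/-- `g` is the weak derivative of `f` on `ℝ ∖ {0}`: integration by parts against all smooth
functions with compact support contained in `ℝ ∖ {0}`. -/
def HasWeakDeriv (f g : ℝ → ℂ) : Prop :=
  ∀ φ : ℝ → ℝ, ContDiff ℝ (⊤ : ℕ∞) φ → HasCompactSupport φ → tsupport φ ⊆ {0}ᶜ →
    ∫ x, deriv φ x • f x = -∫ x, φ x • g x

/-- The trace `f(0+) = a`, as an essential one-sided limit, i.e. a limit up to null sets. (For `f`
in the Sobolev space `H¹(0, ∞)` it is the value at `0+` of the continuous representative.) -/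
def TraceRight (f : ℝ → ℂ) (a : ℂ) : Prop :=
  Tendsto f (𝓝[>] 0 ⊓ ae volume) (𝓝 a)

/-- The trace `f(0-) = a`, as an essential one-sided limit. -/
def TraceLeft (f : ℝ → ℂ) (a : ℂ) : Prop :=
  Tendsto f (𝓝[<] 0 ⊓ ae volume) (𝓝 a)

lemma integrable_smul_L2 (u : L2R) {φ : ℝ → ℝ} (hφ : Continuous φ) (hc : HasCompactSupport φ) :
    Integrable (fun x => φ x • u x) := by
  have h : LocallyIntegrable (u : ℝ → ℂ) volume :=
    (Lp.memLp u).locallyIntegrable (by norm_num)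
  exact h.integrable_smul_left_of_hasCompactSupport hφ hc

lemma HasWeakDeriv.congr {f f' g g' : ℝ → ℂ} (h : HasWeakDeriv f g) (hf : f =ᵐ[volume] f')
    (hg : g =ᵐ[volume] g') : HasWeakDeriv f' g' := by
  intro φ h1 h2 h3
  have e1 : ∫ x, deriv φ x • f x = ∫ x, deriv φ x • f' x :=
    integral_congr_ae (hf.mono fun x hx => by simp only [hx])
  have e2 : ∫ x, φ x • g x = ∫ x, φ x • g' x :=
    integral_congr_ae (hg.mono fun x hx => by simp only [hx])
  rw [← e1, ← e2, h φ h1 h2 h3]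

lemma HasWeakDeriv.add_L2 {u u₁ v v₁ : L2R} (hu : HasWeakDeriv u u₁) (hv : HasWeakDeriv v v₁) :
    HasWeakDeriv (u + v : L2R) (u₁ + v₁ : L2R) := by
  refine HasWeakDeriv.congr (f := fun x => u x + v x) (g := fun x => u₁ x + v₁ x) ?_
    (Lp.coeFn_add u v).symm (Lp.coeFn_add u₁ v₁).symm
  intro φ h1 h2 h3
  have hd : Continuous (deriv φ) := h1.continuous_deriv (by simp)
  simp only [smul_add]
  rw [integral_add (integrable_smul_L2 u hd h2.deriv) (integrable_smul_L2 v hd h2.deriv),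
    integral_add (integrable_smul_L2 u₁ h1.continuous h2) (integrable_smul_L2 v₁ h1.continuous h2),
    hu φ h1 h2 h3, hv φ h1 h2 h3, neg_add]

lemma HasWeakDeriv.smul_L2 {u u₁ : L2R} (c : ℂ) (hu : HasWeakDeriv u u₁) :
    HasWeakDeriv (c • u : L2R) (c • u₁ : L2R) := by
  refine HasWeakDeriv.congr (f := fun x => c • u x) (g := fun x => c • u₁ x) ?_
    (Lp.coeFn_smul c u).symm (Lp.coeFn_smul c u₁).symm
  intro φ h1 h2 h3
  simp only [smul_comm _ c]
  rw [integral_smul, integral_smul, hu φ h1 h2 h3, smul_neg]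

lemma HasWeakDeriv.unique_L2 {u u₁ v₁ : L2R} (h : HasWeakDeriv u u₁) (h' : HasWeakDeriv u v₁) :
    u₁ = v₁ := by
  have hl : LocallyIntegrable ((u₁ - v₁ : L2R) : ℝ → ℂ) volume :=
    (Lp.memLp (u₁ - v₁)).locallyIntegrable (by norm_num)
  have key := IsOpen.ae_eq_zero_of_integral_contDiff_smul_eq_zero (μ := (volume : Measure ℝ))
    (U := ({0}ᶜ : Set ℝ)) isOpen_compl_singleton (hl.locallyIntegrableOn _) (by
      intro φ h1 h2 h3
      have e : ∫ x, φ x • (u₁ - v₁ : L2R) x = ∫ x, (φ x • u₁ x - φ x • v₁ x) := by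
        refine integral_congr_ae ?_
        filter_upwards [Lp.coeFn_sub u₁ v₁] with x hx
        rw [hx, Pi.sub_apply, smul_sub]
      rw [e, integral_sub (integrable_smul_L2 u₁ h1.continuous h2)
        (integrable_smul_L2 v₁ h1.continuous h2)]
      have := (h φ h1 h2 h3).symm.trans (h' φ h1 h2 h3)
      rw [neg_inj] at this
      rw [this, sub_self])
  have h0 : ∀ᵐ x : ℝ, x ∈ ({0}ᶜ : Set ℝ) := by
    simp [ae_iff]
  rw [← sub_eq_zero]
  refine Lp.ext ?_
  filter_upwards [key, h0, Lp.coeFn_zero ℂ 2 (volume : Measure ℝ)] with x hx hx0 hz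
  rw [hx hx0, hz]; rfl

/-- `ψ` lies in the domain of the operator `H_γ` of the attractive `δ'` interaction, with first and
second weak derivatives `ψ₁`, `ψ₂`: `ψ ∈ H²(ℝ ∖ {0})`, `ψ'(0+) = ψ'(0-)` and
`ψ(0+) - ψ(0-) = -γ ψ'(0+)`. -/
structure IsDomainElement (γ : ℝ) (ψ ψ₁ ψ₂ : L2R) : Prop where
  weakDeriv_one : HasWeakDeriv ψ ψ₁
  weakDeriv_two : HasWeakDeriv ψ₁ ψ₂
  boundary : ∃ a b d : ℂ, TraceRight ψ a ∧ TraceLeft ψ b ∧ TraceRight ψ₁ d ∧ TraceLeft ψ₁ d ∧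
    a - b = -(γ : ℂ) * d

lemma Trace.congr {l : Filter ℝ} {f g : ℝ → ℂ} {a : ℂ} (h : Tendsto f (l ⊓ ae volume) (𝓝 a))
    (hfg : f =ᵐ[volume] g) : Tendsto g (l ⊓ ae volume) (𝓝 a) :=
  h.congr' (hfg.filter_mono inf_le_right)

lemma Trace.add_L2 {l : Filter ℝ} {u v : L2R} {a b : ℂ} (hu : Tendsto u (l ⊓ ae volume) (𝓝 a))
    (hv : Tendsto v (l ⊓ ae volume) (𝓝 b)) :
    Tendsto (u + v : L2R) (l ⊓ ae volume) (𝓝 (a + b)) :=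
  Trace.congr (hu.add hv) (Lp.coeFn_add u v).symm

lemma Trace.smul_L2 {l : Filter ℝ} {u : L2R} {a : ℂ} (c : ℂ)
    (hu : Tendsto u (l ⊓ ae volume) (𝓝 a)) :
    Tendsto (c • u : L2R) (l ⊓ ae volume) (𝓝 (c * a)) :=
  Trace.congr (hu.const_smul c) (Lp.coeFn_smul c u).symm

lemma IsDomainElement.add {γ : ℝ} {u u₁ u₂ v v₁ v₂ : L2R} (hu : IsDomainElement γ u u₁ u₂)
    (hv : IsDomainElement γ v v₁ v₂) : IsDomainElement γ (u + v) (u₁ + v₁) (u₂ + v₂) := by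
  obtain ⟨a, b, d, h1, h2, h3, h4, h5⟩ := hu.boundary
  obtain ⟨a', b', d', k1, k2, k3, k4, k5⟩ := hv.boundary
  refine ⟨hu.1.add_L2 hv.1, hu.2.add_L2 hv.2, a + a', b + b', d + d', Trace.add_L2 h1 k1,
    Trace.add_L2 h2 k2, Trace.add_L2 h3 k3, Trace.add_L2 h4 k4, ?_⟩
  linear_combination h5 + k5

lemma IsDomainElement.smul {γ : ℝ} {u u₁ u₂ : L2R} (c : ℂ) (hu : IsDomainElement γ u u₁ u₂) :
    IsDomainElement γ (c • u) (c • u₁) (c • u₂) := by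
  obtain ⟨a, b, d, h1, h2, h3, h4, h5⟩ := hu.boundary
  refine ⟨hu.1.smul_L2 c, hu.2.smul_L2 c, c * a, c * b, c * d, Trace.smul_L2 c h1,
    Trace.smul_L2 c h2, Trace.smul_L2 c h3, Trace.smul_L2 c h4, ?_⟩
  linear_combination c * h5

lemma isDomainElement_zero (γ : ℝ) : IsDomainElement γ 0 0 0 := by
  have hw : HasWeakDeriv (0 : L2R) (0 : L2R) := by
    refine HasWeakDeriv.congr (f := fun _ => 0) (g := fun _ => 0) ?_
      (Lp.coeFn_zero ℂ 2 (volume : Measure ℝ)).symm (Lp.coeFn_zero ℂ 2 (volume : Measure ℝ)).symm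
    intro φ _ _ _
    simp
  have ht : ∀ l : Filter ℝ, Tendsto (0 : L2R) (l ⊓ ae volume) (𝓝 0) := fun l =>
    Trace.congr (f := fun _ => 0) tendsto_const_nhds
      (Lp.coeFn_zero ℂ 2 (volume : Measure ℝ)).symm
  exact ⟨hw, hw, 0, 0, 0, ht _, ht _, ht _, ht _, by simp⟩

/-- The graph `{(ψ, -ψ'')}` of `H_γ`. -/
def hamiltonianGraph (γ : ℝ) : Submodule ℂ (L2R × L2R) where
  carrier := {p | ∃ ψ₁ ψ₂ : L2R, IsDomainElement γ p.1 ψ₁ ψ₂ ∧ p.2 = -ψ₂}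
  add_mem' := by
    rintro p q ⟨u₁, u₂, hu, hu'⟩ ⟨v₁, v₂, hv, hv'⟩
    exact ⟨u₁ + v₁, u₂ + v₂, hu.add hv, by rw [Prod.snd_add, hu', hv', neg_add]⟩
  zero_mem' := ⟨0, 0, isDomainElement_zero γ, by simp⟩
  smul_mem' := by
    rintro c p ⟨u₁, u₂, hu, hu'⟩
    exact ⟨c • u₁, c • u₂, hu.smul c, by rw [Prod.smul_snd, hu', smul_neg]⟩

/-- The Hamiltonian `H_γ ψ = -ψ''` (`x ≠ 0`) of the `δ'` interaction, an unbounded operator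
in `L²(ℝ)`. -/
def hamiltonian (γ : ℝ) : L2R →ₗ.[ℂ] L2R :=
  (hamiltonianGraph γ).toLinearPMap

/-- The action of `H_γ` is well defined: its graph is `{(ψ, -ψ'')}`. -/
theorem hamiltonian_graph (γ : ℝ) : (hamiltonian γ).graph = hamiltonianGraph γ := by
  refine Submodule.toLinearPMap_graph_eq _ ?_
  rintro ⟨u, v⟩ ⟨u₁, u₂, hu, hv⟩ h0
  simp only at hu hv h0
  subst h0
  have h1 : u₁ = 0 := hu.1.unique_L2 (isDomainElement_zero γ).1
  subst h1
  have h2 : u₂ = 0 := hu.2.unique_L2 (isDomainElement_zero γ).2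
  rw [hv, h2, neg_zero]

/-- The potential `ω (μ + 1) (2μ + 1) / cosh² (μ √ω (|x| + y))`, which is
`(2μ + 1) λ |ψ|^{2μ}` for the symmetric stationary state `ψ`. -/
def symPotential (μ ω y x : ℝ) : ℝ :=
  ω * (μ + 1) * (2 * μ + 1) / Real.cosh (μ * √ω * (|x| + y)) ^ 2

lemma continuous_symPotential (μ ω y : ℝ) : Continuous (symPotential μ ω y) := by
  unfold symPotential
  refine Continuous.div (by fun_prop) ?_ fun x => ?_
  · exact (Real.continuous_cosh.comp (by fun_prop)).pow 2
  · exact pow_ne_zero _ (Real.cosh_pos _).ne'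

lemma abs_symPotential_le (μ ω y x : ℝ) :
    |symPotential μ ω y x| ≤ |ω * (μ + 1) * (2 * μ + 1)| := by
  unfold symPotential
  rw [abs_div, abs_of_nonneg (sq_nonneg (Real.cosh _))]
  exact div_le_self (abs_nonneg _) (one_le_pow₀ (Real.one_le_cosh _))

lemma memLp_symPotential_mul (μ ω y : ℝ) (u : L2R) :
    MemLp (fun x => (symPotential μ ω y x : ℂ) * u x) 2 volume := by
  refine MemLp.of_le_mul (c := |ω * (μ + 1) * (2 * μ + 1)|) (Lp.memLp u) ?_ ?_
  · exact (Complex.continuous_ofReal.comp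
      (continuous_symPotential μ ω y)).aestronglyMeasurable.mul (Lp.aestronglyMeasurable u)
  · refine Eventually.of_forall fun x => ?_
    rw [norm_mul, Complex.norm_real, Real.norm_eq_abs]
    exact mul_le_mul_of_nonneg_right (abs_symPotential_le μ ω y x) (norm_nonneg _)

/-- Multiplication by the potential, an everywhere defined operator in `L²(ℝ)`. -/
def mulSymPotential (μ ω y : ℝ) : L2R →ₗ[ℂ] L2R where
  toFun u := (memLp_symPotential_mul μ ω y u).toLp _
  map_add' u v := by
    rw [← MemLp.toLp_add]
    refine MemLp.toLp_congr _ _ ?_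
    filter_upwards [Lp.coeFn_add u v] with x hx
    simp only [hx, Pi.add_apply, mul_add]
  map_smul' c u := by
    rw [RingHom.id_apply, ← MemLp.toLp_const_smul]
    refine MemLp.toLp_congr _ _ ?_
    filter_upwards [Lp.coeFn_smul c u] with x hx
    simp only [hx, Pi.smul_apply, smul_eq_mul]
    ring

/-- The operator `L₁ = H_γ + ω - ω (μ + 1) (2μ + 1) / cosh² (μ √ω (|x| + y))` with domain
`D(L₁) = D(H_γ)`, an unbounded operator in `L²(ℝ)`. -/
def L1sym (γ μ ω y : ℝ) : L2R →ₗ.[ℂ] L2R :=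
  ((ω : ℂ) • LinearMap.id - mulSymPotential μ ω y) +ᵥ hamiltonian γ

/-- The eigenspace `{u ∈ D(T) | T u = z u}` of an unbounded operator. -/
def eigenspace {E : Type*} [AddCommGroup E] [Module ℂ E] (T : E →ₗ.[ℂ] E) (z : ℂ) :
    Submodule ℂ E :=
  (LinearMap.ker (T.toFun - z • T.domain.subtype)).map T.domain.subtype

/-- The kernel `{u ∈ D(T) | T u = 0}` of an unbounded operator. -/
def kernel {E : Type*} [AddCommGroup E] [Module ℂ E] (T : E →ₗ.[ℂ] E) : Submodule ℂ E :=
  (LinearMap.ker T.toFun).map T.domain.subtype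

/-- The set of the negative eigenvalues. -/
def negEigenvalues {E : Type*} [AddCommGroup E] [Module ℂ E] (T : E →ₗ.[ℂ] E) : Set ℝ :=
  {ν | ν < 0 ∧ eigenspace T ν ≠ ⊥}

/-- The function `ξ₋₁`. -/
def xiMinusOne (μ ω y x : ℝ) : ℝ :=
  Real.sinh (μ * √ω * (|x| + y)) / Real.cosh (μ * √ω * (|x| + y)) ^ (1 + 1 / μ)

/-- The frequency `ω₀ = 4 / γ²` of the linear ground state. -/
def omegaZero (γ : ℝ) : ℝ :=
  4 / γ ^ 2

/-- The bifurcation frequency `ω* = (4 / γ²) (μ + 1) / μ`. -/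
def omegaStar (γ μ : ℝ) : ℝ :=
  4 / γ ^ 2 * ((μ + 1) / μ)

/-- The parameter `y = (2μ√ω)⁻¹ log ((γ√ω + 2) / (γ√ω - 2))` of the symmetric stationary state.
For `ω > ω₀` it is the solution of `tanh (μ √ω y) = 2 / (γ √ω)`. -/
def symShift (γ μ ω : ℝ) : ℝ :=
  1 / (2 * μ * √ω) * Real.log ((γ * √ω + 2) / (γ * √ω - 2))

end DeltaPrime

end

noncomputable section

namespace DeltaPrime

/-! ### Power series with polynomially bounded coefficients -/

/-! With `a = μ√ω` and `s = 1 + 1/μ`, the equation `L₁ψ = νψ` on each half-line is the Pöschl–Teller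
equation `u'' = (κ² - a² s (s + 1) / cosh² (a (x + y))) u`, where `κ² = ω - ν`. Its `L²` solutions
on `(0, ∞)` are the multiples of one decaying solution `u`, so `ψ` is `c u(x)` on the right and `d
u(-x)` on the left. The boundary conditions then leave two possibilities: an even eigenfunction,
when `u'(0) = 0`, or an odd one, when `u'(0) + (2/γ) u(0) = 0`.

Negative `ν` means `κ > √ω = a (s - 1)`, and at the threshold `κ = √ω` the decaying solution is the
explicit function `sinh / cosh ^ s`, positive because `y > 0`. Wronskian comparison shows that `u >
0` for `κ ≥ √ω` and that `u'(0)/u(0)` decreases strictly with `κ` (`ptSol_pos`, `ptSol_slope_lt`);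
it falls below any given `-β`. So each condition `u'(0) + β u(0) = 0` holds for at most one `κ >
√ω`, and for one as soon as the threshold solution has `u'(0) + β u(0) > 0` (`robin_unique`,
`exists_robin`).

By `ptXi_boundary`, the threshold value for `β = 2/γ` has the sign of `ω - ω₀`, hence is positive:
there is always exactly one odd negative eigenvalue. For `β = 0` it has the sign of `ω - ω*`: this
decides whether there is also an even negative eigenvalue, and equality is exactly the case of a
kernel. The two conditions cannot hold at the same `κ` since `u(0) > 0`, so in case c) the
eigenvalues are in fact always distinct.

The intermediate value argument needs a solution continuous in `κ`; it is built from a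
hypergeometric series with bounds uniform in `κ`. Regularity of weak solutions comes from a du
Bois-Reymond argument applied to a Wronskian and then to a quotient. -/

lemma summable_add_one_pow_mul_geometric (p : ℕ) {r : ℝ} (h0 : 0 < r) (h1 : r < 1) :
    Summable fun n : ℕ => ((n : ℝ) + 1) ^ p * r ^ n := by
  have h := summable_pow_mul_geometric_of_norm_lt_one (R := ℝ) p (r := r)
    (by rwa [Real.norm_of_nonneg h0.le])
  have h' := ((summable_nat_add_iff 1).2 h).mul_right r⁻¹
  refine h'.congr fun n => ?_
  push_cast
  rw [pow_succ]
  field_simp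

lemma exists_between_abs_one {z : ℝ} (hz : |z| < 1) : ∃ r, |z| < r ∧ 0 < r ∧ r < 1 := by
  obtain ⟨r, h1, h2⟩ := exists_between hz
  exact ⟨r, h1, (abs_nonneg z).trans_lt h1, h2⟩

lemma summable_powerSeries {c : ℕ → ℝ} {M : ℝ} {p : ℕ} (hc : ∀ n, |c n| ≤ M * ((n : ℝ) + 1) ^ p)
    {z : ℝ} (hz : |z| < 1) : Summable fun n => c n * z ^ n := by
  obtain ⟨r, h1, h2, h3⟩ := exists_between_abs_one hz
  refine Summable.of_norm_bounded ((summable_add_one_pow_mul_geometric p h2 h3).mul_left M)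
    fun n => ?_
  rw [norm_mul, norm_pow, Real.norm_eq_abs, Real.norm_eq_abs, ← mul_assoc]
  exact mul_le_mul (hc n) (pow_le_pow_left₀ (abs_nonneg _) h1.le _) (by positivity)
    ((abs_nonneg _).trans (hc n))

/-- Coefficients of the formal derivative. -/
def derivCoeff (c : ℕ → ℝ) (n : ℕ) : ℝ := ((n : ℝ) + 1) * c (n + 1)

/-- The factor `2 ^ p` absorbs the index shift, by `n + 2 ≤ 2 (n + 1)`. The class of polynomially
bounded coefficients is thus stable, and termwise differentiation can be iterated. -/
lemma abs_derivCoeff_le {c : ℕ → ℝ} {M : ℝ} {p : ℕ} (hc : ∀ n, |c n| ≤ M * ((n : ℝ) + 1) ^ p)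
    (n : ℕ) : |derivCoeff c n| ≤ (M * 2 ^ p) * ((n : ℝ) + 1) ^ (p + 1) := by
  have hM : 0 ≤ M := by simpa using (abs_nonneg _).trans (hc 0)
  have h := hc (n + 1)
  push_cast at h
  have h2 : ((n : ℝ) + 1 + 1) ^ p ≤ (2 * ((n : ℝ) + 1)) ^ p :=
    pow_le_pow_left₀ (by positivity) (by linarith [(Nat.cast_nonneg n : (0 : ℝ) ≤ n)]) _
  rw [mul_pow] at h2
  have hn : (0 : ℝ) < (n : ℝ) + 1 := by positivity
  rw [derivCoeff, abs_mul, abs_of_pos hn, pow_succ]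
  calc ((n : ℝ) + 1) * |c (n + 1)| ≤ ((n : ℝ) + 1) * (M * (2 ^ p * ((n : ℝ) + 1) ^ p)) := by
        gcongr
        exact h.trans (mul_le_mul_of_nonneg_left h2 hM)
    _ = _ := by ring

lemma hasDerivAt_powerSeries {c : ℕ → ℝ} {M : ℝ} {p : ℕ}
    (hc : ∀ n, |c n| ≤ M * ((n : ℝ) + 1) ^ p) {z : ℝ} (hz : |z| < 1) :
    HasDerivAt (fun z => ∑' n, c n * z ^ n) (∑' n, derivCoeff c n * z ^ n) z := by
  obtain ⟨r, h1, h2, h3⟩ := exists_between_abs_one hz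
  have hM : 0 ≤ M := by simpa using (abs_nonneg _).trans (hc 0)
  have hs : Summable fun n : ℕ => M * r⁻¹ * (((n : ℝ) + 1) ^ (p + 1) * r ^ n) :=
    (summable_add_one_pow_mul_geometric (p + 1) h2 h3).mul_left _
  have hb : ∀ (n : ℕ), ∀ x ∈ Metric.ball (0 : ℝ) r,
      ‖c n * ((n : ℝ) * x ^ (n - 1))‖ ≤ M * r⁻¹ * (((n : ℝ) + 1) ^ (p + 1) * r ^ n) := by
    intro n x hx
    rw [mem_ball_zero_iff, Real.norm_eq_abs] at hx
    rcases n with _ | n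
    · simp; positivity
    · rw [norm_mul, norm_mul, norm_pow]
      simp only [Real.norm_eq_abs, Nat.abs_cast, Nat.add_sub_cancel]
      calc |c (n + 1)| * (((n + 1 : ℕ) : ℝ) * |x| ^ n)
          ≤ (M * (((n + 1 : ℕ) : ℝ) + 1) ^ p) * ((((n + 1 : ℕ) : ℝ) + 1) * r ^ n) := by
            refine mul_le_mul (hc _) (mul_le_mul (by linarith)
              (pow_le_pow_left₀ (abs_nonneg _) hx.le _) (by positivity) (by positivity))
              (by positivity) (by positivity)
        _ = _ := by rw [pow_succ r n]; field_simp; ring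
  have key := hasDerivAt_tsum_of_isPreconnected (g := fun n z => c n * z ^ n)
    (g' := fun n z => c n * ((n : ℝ) * z ^ (n - 1))) hs Metric.isOpen_ball
    (convex_ball (0 : ℝ) r).isPreconnected
    (fun n x _ => (hasDerivAt_pow n x).const_mul (c n)) hb (Metric.mem_ball_self h2)
    (summable_powerSeries hc (by simp)) (y := z) (by simpa using h1)
  have hs' : Summable fun n => c n * ((n : ℝ) * z ^ (n - 1)) :=
    Summable.of_norm_bounded hs fun n => hb n z (by simpa using h1)
  rw [hs'.tsum_eq_zero_add] at key
  simp only [Nat.cast_zero, zero_mul, mul_zero, zero_add, Nat.add_sub_cancel] at key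
  convert! key using 3 with n
  rw [derivCoeff]; push_cast; ring

/-! ### The decaying solution of the Pöschl–Teller equation -/

/-- Taylor coefficients at `0` of the hypergeometric function `F(-s, s + 1; 1 + k; z)`. -/
def hyperCoeff (s k : ℝ) : ℕ → ℝ
  | 0 => 1
  | n + 1 => hyperCoeff s k n * (((n : ℝ) * (n + 1) - s * (s + 1)) / ((n + 1) * (n + 1 + k)))

lemma hyperCoeff_succ (s k : ℝ) (n : ℕ) : hyperCoeff s k (n + 1) =
    hyperCoeff s k n * (((n : ℝ) * (n + 1) - s * (s + 1)) / ((n + 1) * (n + 1 + k))) := rfl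

/-- A positive `k` only enlarges the denominators in the recursion. -/
lemma abs_hyperCoeff_le (s : ℝ) {k : ℝ} (hk : 0 ≤ k) (n : ℕ) :
    |hyperCoeff s k n| ≤ |hyperCoeff s 0 n| := by
  induction n with
  | zero => simp [hyperCoeff]
  | succ n ih =>
    rw [hyperCoeff_succ, hyperCoeff_succ, abs_mul, abs_mul]
    refine mul_le_mul ih ?_ (abs_nonneg _) (abs_nonneg _)
    rw [abs_div, abs_div]
    refine div_le_div_of_nonneg_left (abs_nonneg _) (by simp; positivity) ?_
    rw [abs_of_nonneg (by positivity), abs_of_nonneg (by positivity)]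
    gcongr

/-- For `k = 0` the ratio of consecutive coefficients has modulus at most `1` once `n ≥ s (s + 1)`,
so finitely many coefficients control all. Uniformity in `k` is what later gives continuity in the
decay rate. -/
lemma exists_hyperCoeff_bound {s : ℝ} (hs : 0 ≤ s) :
    ∃ M : ℝ, ∀ k, 0 ≤ k → ∀ n, |hyperCoeff s k n| ≤ M := by
  obtain ⟨N, hN⟩ := exists_nat_ge (s * (s + 1))
  refine ⟨∑ i ∈ Finset.range (N + 1), |hyperCoeff s 0 i|, fun k hk n =>
    (abs_hyperCoeff_le s hk n).trans ?_⟩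
  have small : ∀ n, n ≤ N → |hyperCoeff s 0 n| ≤ ∑ i ∈ Finset.range (N + 1), |hyperCoeff s 0 i| :=
    fun n hn => Finset.single_le_sum (f := fun i => |hyperCoeff s 0 i|)
      (fun i _ => abs_nonneg _) (Finset.mem_range.2 (by omega))
  rcases le_total n N with h | h
  · exact small n h
  · induction n, h using Nat.le_induction with
    | base => exact small N le_rfl
    | succ n hn ih =>
      refine le_trans ?_ ih
      rw [hyperCoeff_succ, abs_mul]
      refine mul_le_of_le_one_right (abs_nonneg _) ?_
      have hnN : (N : ℝ) ≤ n := by exact_mod_cast hn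
      have h0 : (0 : ℝ) ≤ n := Nat.cast_nonneg n
      rw [abs_div, div_le_one (by rw [abs_pos]; positivity), add_zero,
        abs_of_nonneg (a := ((n : ℝ) + 1) * (n + 1)) (by positivity), abs_of_nonneg]
      · nlinarith [mul_nonneg hs (by linarith : 0 ≤ s + 1)]
      · nlinarith

/-- The function `F(-s, s + 1; 1 + k; z)`. -/
def hyperF (s k z : ℝ) : ℝ := ∑' n, hyperCoeff s k n * z ^ n

/-- The derivative of `hyperF` in `z`. -/
def hyperF' (s k z : ℝ) : ℝ := ∑' n, derivCoeff (hyperCoeff s k) n * z ^ n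

/-- The second derivative of `hyperF` in `z`. -/
def hyperF'' (s k z : ℝ) : ℝ := ∑' n, derivCoeff (derivCoeff (hyperCoeff s k)) n * z ^ n

lemma hasDerivAt_hyperF {s k z : ℝ} (hs : 0 ≤ s) (hk : 0 ≤ k) (hz : |z| < 1) :
    HasDerivAt (hyperF s k) (hyperF' s k z) z := by
  obtain ⟨M, hM⟩ := exists_hyperCoeff_bound hs
  exact hasDerivAt_powerSeries (M := M) (p := 0) (fun n => by simpa using hM k hk n) hz

lemma hasDerivAt_hyperF' {s k z : ℝ} (hs : 0 ≤ s) (hk : 0 ≤ k) (hz : |z| < 1) :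
    HasDerivAt (hyperF' s k) (hyperF'' s k z) z := by
  obtain ⟨M, hM⟩ := exists_hyperCoeff_bound hs
  exact hasDerivAt_powerSeries (abs_derivCoeff_le (M := M) (p := 0)
    (fun n => by simpa using hM k hk n)) hz

lemma hyperF_ode {s k z : ℝ} (hs : 0 ≤ s) (hk : 0 ≤ k) (hz : |z| < 1) :
    z * (1 - z) * hyperF'' s k z + (1 + k - 2 * z) * hyperF' s k z
      + s * (s + 1) * hyperF s k z = 0 := by
  obtain ⟨M, hM⟩ := exists_hyperCoeff_bound hs
  have b0 : ∀ n, |hyperCoeff s k n| ≤ M * ((n : ℝ) + 1) ^ 0 := fun n => by simpa using hM k hk n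
  have b1 := abs_derivCoeff_le b0
  have b2 := abs_derivCoeff_le b1
  have s0 : HasSum _ (hyperF s k z) := (summable_powerSeries b0 hz).hasSum
  have s1 : HasSum _ (hyperF' s k z) := (summable_powerSeries b1 hz).hasSum
  have s2 : HasSum _ (hyperF'' s k z) := (summable_powerSeries b2 hz).hasSum
  set c := hyperCoeff s k with hc
  -- Multiplication by `z` shifts the index by one; each shifted series has a vanishing zeroth term.
  -- Once all series are aligned at `z ^ n`, the equation is the coefficient recursion.
  have t1 : HasSum (fun n : ℕ => (n : ℝ) * c n * z ^ n) (z * hyperF' s k z) := by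
    have := HasSum.zero_add (f := fun n : ℕ => (n : ℝ) * c n * z ^ n) (m := z * hyperF' s k z) (by
      refine (s1.mul_left z).congr_fun fun n => ?_
      simp only [derivCoeff]; push_cast; ring)
    simpa using this
  have t2 : HasSum (fun n : ℕ => (n : ℝ) * (n + 1) * c (n + 1) * z ^ n) (z * hyperF'' s k z) := by
    have := HasSum.zero_add (f := fun n : ℕ => (n : ℝ) * (n + 1) * c (n + 1) * z ^ n)
      (m := z * hyperF'' s k z) (by
      refine (s2.mul_left z).congr_fun fun n => ?_
      simp only [derivCoeff]; push_cast; ring)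
    simpa using this
  have t3 : HasSum (fun n : ℕ => (n : ℝ) * (n - 1) * c n * z ^ n)
      (z * (z * hyperF'' s k z)) := by
    have := HasSum.zero_add (f := fun n : ℕ => (n : ℝ) * (n - 1) * c n * z ^ n)
      (m := z * (z * hyperF'' s k z)) (by
      refine (t2.mul_left z).congr_fun fun n => ?_
      push_cast; ring)
    simpa using this
  have total := (((t2.sub t3).add (s1.mul_left (1 + k))).sub (t1.mul_left 2)).add
    (s0.mul_left (s * (s + 1)))
  have hz0 : HasSum (fun _ : ℕ => (0 : ℝ)) 0 := hasSum_zero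
  have e := total.unique (hz0.congr_fun fun n => by
    have hn : (0 : ℝ) < (n : ℝ) + 1 := by positivity
    have hk' : (0 : ℝ) < (n : ℝ) + 1 + k := by positivity
    have hrec : c (n + 1) * (((n : ℝ) + 1) * (n + 1 + k)) =
        c n * ((n : ℝ) * (n + 1) - s * (s + 1)) := by
      rw [hc, hyperCoeff_succ]
      field_simp
    simp only [derivCoeff]
    linear_combination (z ^ n) * hrec)
  linear_combination e

/-! ### Exponentially decaying solutions of `u'' = Q u` -/

/-- `u` with derivative `v` solves `u'' = Q u` and both decay exponentially at `+∞`. -/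
structure IsDecayingSolution (Q u v : ℝ → ℝ) : Prop where
  hasDerivAt : ∀ x, HasDerivAt u (v x) x
  hasDerivAt_deriv : ∀ x, HasDerivAt v (Q x * u x) x
  bound : ∃ C κ : ℝ, 0 < κ ∧ ∀ x, 0 ≤ x →
    |u x| ≤ C * Real.exp (-κ * x) ∧ |v x| ≤ C * Real.exp (-κ * x)

namespace IsDecayingSolution

variable {Q Q₁ Q₂ u u₁ u₂ v v₁ v₂ : ℝ → ℝ}

lemma continuous (h : IsDecayingSolution Q u v) : Continuous u :=
  continuous_iff_continuousAt.2 fun x => (h.hasDerivAt x).continuousAt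

lemma continuous_deriv (h : IsDecayingSolution Q u v) : Continuous v :=
  continuous_iff_continuousAt.2 fun x => (h.hasDerivAt_deriv x).continuousAt

/-- Bootstrapping through `u' = v`, `v' = Q u`. Smoothness is needed because test functions get
multiplied by `u` and `v` and divided by `u`. -/
lemma contDiff (h : IsDecayingSolution Q u v) (hQ : ContDiff ℝ (⊤ : ℕ∞) Q) :
    ContDiff ℝ (⊤ : ℕ∞) u ∧ ContDiff ℝ (⊤ : ℕ∞) v := by
  have hu : deriv u = v := funext fun x => (h.hasDerivAt x).deriv
  have hv : deriv v = fun x => Q x * u x := funext fun x => (h.hasDerivAt_deriv x).deriv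
  have key : ∀ n : ℕ, ContDiff ℝ n u ∧ ContDiff ℝ n v := by
    intro n
    induction n with
    | zero => exact ⟨contDiff_zero.2 h.continuous, contDiff_zero.2 h.continuous_deriv⟩
    | succ n ih =>
      have hQn : ContDiff ℝ n Q := hQ.of_le (by exact_mod_cast le_top)
      refine ⟨?_, ?_⟩
      · rw [Nat.cast_add, Nat.cast_one, contDiff_succ_iff_deriv]
        exact ⟨fun x => (h.hasDerivAt x).differentiableAt, by simp, hu ▸ ih.2⟩
      · rw [Nat.cast_add, Nat.cast_one, contDiff_succ_iff_deriv]
        exact ⟨fun x => (h.hasDerivAt_deriv x).differentiableAt, by simp, hv ▸ hQn.mul ih.1⟩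
  exact ⟨contDiff_infty.2 fun n => (key n).1, contDiff_infty.2 fun n => (key n).2⟩

lemma tendsto_zero (h : IsDecayingSolution Q u v) :
    Tendsto u atTop (𝓝 0) ∧ Tendsto v atTop (𝓝 0) := by
  obtain ⟨C, κ, hκ, hb⟩ := h.bound
  have ht : Tendsto (fun x => C * Real.exp (-κ * x)) atTop (𝓝 0) := by
    have : Tendsto (fun x : ℝ => -κ * x) atTop atBot :=
      tendsto_id.const_mul_atTop_of_neg (neg_lt_zero.2 hκ)
    simpa using (Real.tendsto_exp_atBot.comp this).const_mul C
  have hb' := eventually_ge_atTop (0 : ℝ)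
  exact ⟨squeeze_zero_norm' (hb'.mono fun x hx => (hb x hx).1) ht,
    squeeze_zero_norm' (hb'.mono fun x hx => (hb x hx).2) ht⟩

lemma hasDerivAt_wronskian (h₁ : IsDecayingSolution Q₁ u₁ v₁) (h₂ : IsDecayingSolution Q₂ u₂ v₂)
    (x : ℝ) : HasDerivAt (fun x => u₁ x * v₂ x - v₁ x * u₂ x)
      ((Q₂ x - Q₁ x) * (u₁ x * u₂ x)) x := by
  convert! ((h₁.hasDerivAt x).mul (h₂.hasDerivAt_deriv x)).sub
    ((h₁.hasDerivAt_deriv x).mul (h₂.hasDerivAt x)) using 1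
  ring

lemma tendsto_wronskian (h₁ : IsDecayingSolution Q₁ u₁ v₁) (h₂ : IsDecayingSolution Q₂ u₂ v₂) :
    Tendsto (fun x => u₁ x * v₂ x - v₁ x * u₂ x) atTop (𝓝 0) := by
  simpa using (h₁.tendsto_zero.1.mul h₂.tendsto_zero.2).sub
    (h₁.tendsto_zero.2.mul h₂.tendsto_zero.1)

/-- Sturm comparison for the slopes of positive decaying solutions. -/
lemma slope_lt (h₁ : IsDecayingSolution Q₁ u₁ v₁) (h₂ : IsDecayingSolution Q₂ u₂ v₂) {x₀ : ℝ}
    (hQ : ∀ x, x₀ < x → Q₂ x < Q₁ x) (p₁ : ∀ x, x₀ < x → 0 < u₁ x) (p₂ : ∀ x, x₀ < x → 0 < u₂ x) :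
    v₁ x₀ * u₂ x₀ < u₁ x₀ * v₂ x₀ := by
  have hW := hasDerivAt_wronskian h₁ h₂
  have anti : StrictAntiOn (fun x => u₁ x * v₂ x - v₁ x * u₂ x) (Set.Ici x₀) := by
    refine strictAntiOn_of_deriv_neg (convex_Ici x₀)
      (fun x _ => (hW x).continuousAt.continuousWithinAt) fun x hx => ?_
    rw [interior_Ici, Set.mem_Ioi] at hx
    rw [(hW x).deriv]
    exact mul_neg_of_neg_of_pos (sub_neg.2 (hQ x hx)) (mul_pos (p₁ x hx) (p₂ x hx))
  -- The Wronskian decreases to `0`, so it is nonnegative at `x₀ + 1`; the strict decrease from `x₀`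
  -- to `x₀ + 1` makes it positive at `x₀`.
  have h1 : 0 ≤ u₁ (x₀ + 1) * v₂ (x₀ + 1) - v₁ (x₀ + 1) * u₂ (x₀ + 1) := by
    refine le_of_tendsto (tendsto_wronskian h₁ h₂) ?_
    filter_upwards [eventually_ge_atTop (x₀ + 1)] with x hx
    exact anti.antitoneOn (Set.mem_Ici.2 (by linarith)) (Set.mem_Ici.2 (by linarith)) hx
  have h2 := anti (Set.mem_Ici.2 le_rfl) (Set.mem_Ici.2 (by linarith)) (lt_add_one x₀)
  simp only at h2
  linarith

/-- The Wronskian of two decaying solutions of the same equation vanishes. -/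
lemma wronskian_eq_zero (h₁ : IsDecayingSolution Q u₁ v₁) (h₂ : IsDecayingSolution Q u₂ v₂)
    (x : ℝ) : u₁ x * v₂ x - v₁ x * u₂ x = 0 := by
  have hW : ∀ x, HasDerivAt (fun x => u₁ x * v₂ x - v₁ x * u₂ x) 0 x := fun x => by
    simpa using hasDerivAt_wronskian h₁ h₂ x
  have hc := is_const_of_deriv_eq_zero (fun x => (hW x).differentiableAt) fun x => (hW x).deriv
  have ht := tendsto_wronskian h₁ h₂
  have : (fun x => u₁ x * v₂ x - v₁ x * u₂ x) = fun _ => u₁ x * v₂ x - v₁ x * u₂ x :=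
    funext fun z => hc z x
  rw [this] at ht
  exact tendsto_nhds_unique tendsto_const_nhds ht

/-- A decaying solution that is positive near `+∞` is positive on `[0, ∞)` if the equation with a
smaller coefficient has a positive decaying solution. -/
lemma pos_of_eventually_pos (h₁ : IsDecayingSolution Q₁ u₁ v₁) (h₂ : IsDecayingSolution Q₂ u₂ v₂)
    (hQ : ∀ x, Q₂ x < Q₁ x) (p₁ : ∀ᶠ x in atTop, 0 < u₁ x) (p₂ : ∀ x, 0 ≤ x → 0 < u₂ x) :
    ∀ x, 0 ≤ x → 0 < u₁ x := by
  by_contra! hcon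
  obtain ⟨x₁, hx₁, hneg⟩ := hcon
  obtain ⟨X, hX⟩ := eventually_atTop.1 p₁
  have hcomp : IsCompact (Set.Icc 0 X ∩ {x | u₁ x ≤ 0}) :=
    isCompact_Icc.inter_right (isClosed_le h₁.continuous continuous_const)
  have hne : (Set.Icc 0 X ∩ {x | u₁ x ≤ 0}).Nonempty :=
    ⟨x₁, ⟨hx₁, by by_contra! h; exact (hX x₁ h.le).not_ge hneg⟩, hneg⟩
  -- At the last point `x₀` where `u₁ ≤ 0`, the value is `0` and the slope is nonnegative;
  -- comparison on `(x₀, ∞)` forces a negative slope there.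
  obtain ⟨x₀, ⟨⟨hx₀, hx₀X⟩, hx₀n⟩, hmax⟩ := hcomp.exists_isGreatest hne
  have hpos : ∀ x, x₀ < x → 0 < u₁ x := by
    intro x hx
    by_contra! hn
    refine (hmax ⟨⟨hx₀.trans hx.le, ?_⟩, hn⟩).not_gt hx
    by_contra! h
    exact (hX x h.le).not_ge hn
  have hzero : u₁ x₀ = 0 := by
    have ht : Tendsto u₁ (𝓝[>] x₀) (𝓝 (u₁ x₀)) :=
      h₁.continuous.continuousAt.mono_left nhdsWithin_le_nhds
    refine le_antisymm hx₀n (ge_of_tendsto ht ?_)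
    filter_upwards [self_mem_nhdsWithin] with x hx using (hpos x hx).le
  have hv : 0 ≤ v₁ x₀ := by
    have hd := (h₁.hasDerivAt x₀).hasDerivWithinAt (s := Set.Ioi x₀)
    rw [hasDerivWithinAt_iff_tendsto_slope' Set.self_notMem_Ioi] at hd
    refine ge_of_tendsto hd ?_
    filter_upwards [self_mem_nhdsWithin] with x hx
    rw [slope_def_field, hzero, sub_zero]
    exact div_nonneg (hpos x hx).le (sub_nonneg.2 (le_of_lt hx))
  have := slope_lt h₁ h₂ (fun x _ => hQ x) hpos fun x hx => p₂ x (hx₀.trans hx.le)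
  rw [hzero, zero_mul] at this
  exact this.not_ge (mul_nonneg hv (p₂ x₀ hx₀).le)

/-- Steep decay for a large coefficient. -/
lemma slope_le_neg (h : IsDecayingSolution Q u v) {M : ℝ} (hM : 0 < M)
    (hQ : ∀ x, 0 ≤ x → M ^ 2 ≤ Q x) (p : ∀ x, 0 ≤ x → 0 < u x) : v 0 ≤ -M * u 0 := by
  -- This function is nondecreasing on `[0, ∞)` with limit `0`, hence nonpositive at `0`.
  have hd : ∀ x, HasDerivAt (fun x => (v x + M * u x) * Real.exp (-M * x))
      ((Q x - M ^ 2) * u x * Real.exp (-M * x)) x := fun x => by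
    have he : HasDerivAt (fun x => Real.exp (-M * x)) (Real.exp (-M * x) * (-M * 1)) x :=
      ((hasDerivAt_id x).const_mul (-M)).exp
    convert! ((h.hasDerivAt_deriv x).add ((h.hasDerivAt x).const_mul M)).mul he using 1
    simp only [Pi.add_apply]
    ring
  have mono : MonotoneOn (fun x => (v x + M * u x) * Real.exp (-M * x)) (Set.Ici 0) := by
    refine monotoneOn_of_deriv_nonneg (convex_Ici 0)
      (fun x _ => (hd x).continuousAt.continuousWithinAt)
      (fun x _ => (hd x).differentiableAt.differentiableWithinAt) fun x hx => ?_
    rw [interior_Ici, Set.mem_Ioi] at hx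
    rw [(hd x).deriv]
    have := hQ x hx.le
    have := p x hx.le
    exact mul_nonneg (mul_nonneg (by linarith) this.le) (Real.exp_pos _).le
  have ht : Tendsto (fun x => (v x + M * u x) * Real.exp (-M * x)) atTop (𝓝 0) := by
    have : Tendsto (fun x : ℝ => -M * x) atTop atBot :=
      tendsto_id.const_mul_atTop_of_neg (neg_lt_zero.2 hM)
    simpa using (h.tendsto_zero.2.add (h.tendsto_zero.1.const_mul M)).mul
      (Real.tendsto_exp_atBot.comp this)
  have : (v 0 + M * u 0) * Real.exp (-M * 0) ≤ 0 := by
    refine ge_of_tendsto ht ?_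
    filter_upwards [eventually_ge_atTop 0] with x hx
    exact mono (Set.mem_Ici.2 le_rfl) hx hx
  simp only [mul_zero, Real.exp_zero, mul_one] at this
  linarith

/-- A decaying solution that is positive near `+∞` is a positive multiple of a positive one. -/
lemma exists_pos_mul (h₁ : IsDecayingSolution Q u₁ v₁) (h₂ : IsDecayingSolution Q u₂ v₂)
    (p₁ : ∀ᶠ x in atTop, 0 < u₁ x) (p₂ : ∀ x, 0 ≤ x → 0 < u₂ x) :
    ∃ c, 0 < c ∧ u₁ 0 = c * u₂ 0 ∧ v₁ 0 = c * v₂ 0 := by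
  have hW := wronskian_eq_zero h₁ h₂
  -- The vanishing Wronskian makes the quotient constant; its sign is read off far to the right.
  have hd : ∀ x, 0 ≤ x → HasDerivAt (fun x => u₁ x / u₂ x) 0 x := fun x hx => by
    have := (h₁.hasDerivAt x).div (h₂.hasDerivAt x) (p₂ x hx).ne'
    rwa [show v₁ x * u₂ x - u₁ x * v₂ x = 0 by linarith [hW x], zero_div] at this
  have hconst : ∀ x, 0 ≤ x → u₁ x / u₂ x = u₁ 0 / u₂ 0 := fun x hx =>
    constant_of_has_deriv_right_zero (a := 0) (b := x)
      (fun t ht => (hd t ht.1).continuousAt.continuousWithinAt)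
      (fun t ht => (hd t ht.1).hasDerivWithinAt) x ⟨hx, le_rfl⟩
  have p0 := p₂ 0 le_rfl
  obtain ⟨X, hX1, hX2⟩ := (p₁.and (eventually_ge_atTop 0)).exists
  refine ⟨u₁ 0 / u₂ 0, ?_, by field_simp, ?_⟩
  · rw [← hconst X hX2]
    exact div_pos hX1 (p₂ X hX2)
  · field_simp
    linarith [hW 0]

end IsDecayingSolution

/-! ### The decaying solutions for the Pöschl–Teller potential -/

/-- The coefficient of the equation `u'' = (κ² - a² s (s + 1) / cosh² (a (x + y))) u`. -/
def ptCoeff (a y s E x : ℝ) : ℝ := E - a ^ 2 * (s * (s + 1)) / Real.cosh (a * (x + y)) ^ 2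

lemma contDiff_ptCoeff (a y s E : ℝ) : ContDiff ℝ (⊤ : ℕ∞) (ptCoeff a y s E) := by
  unfold ptCoeff
  refine contDiff_const.sub (contDiff_const.div ?_ fun x => pow_ne_zero _ (Real.cosh_pos _).ne')
  exact (Real.contDiff_cosh.comp (by fun_prop)).pow 2

/-- The variable in which the Pöschl–Teller equation is hypergeometric. -/
def ptVar (a y x : ℝ) : ℝ := 1 / (1 + Real.exp (2 * a * (x + y)))

lemma ptVar_pos (a y x : ℝ) : 0 < ptVar a y x := by unfold ptVar; positivity

lemma ptVar_lt_one (a y x : ℝ) : ptVar a y x < 1 := by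
  unfold ptVar
  rw [div_lt_one (by positivity)]
  linarith [Real.exp_pos (2 * a * (x + y))]

lemma abs_ptVar_lt_one (a y x : ℝ) : |ptVar a y x| < 1 := by
  rw [abs_of_pos (ptVar_pos a y x)]
  exact ptVar_lt_one a y x

lemma ptVar_le_half {a y x : ℝ} (h : 0 ≤ a * (x + y)) : ptVar a y x ≤ 1 / 2 := by
  unfold ptVar
  refine one_div_le_one_div_of_le (by norm_num) ?_
  have : 1 ≤ Real.exp (2 * a * (x + y)) := Real.one_le_exp (by nlinarith)
  linarith

lemma hasDerivAt_ptVar (a y x : ℝ) :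
    HasDerivAt (ptVar a y) (-2 * a * (ptVar a y x * (1 - ptVar a y x))) x := by
  have he : HasDerivAt (fun x => 1 + Real.exp (2 * a * (x + y)))
      (Real.exp (2 * a * (x + y)) * (2 * a * 1)) x :=
    ((((hasDerivAt_id x).add_const y).const_mul (2 * a)).exp).const_add 1
  have := he.inv (by positivity)
  unfold ptVar
  simp only [one_div]
  convert! this using 1
  have : (0 : ℝ) < 1 + Real.exp (2 * a * (x + y)) := by positivity
  field_simp
  ring

/-- In the variable `z = ptVar a y x` the potential is the polynomial `z (1 - z)` up to a factor, as
is `dz/dx`; this turns the Pöschl–Teller equation into a hypergeometric one. -/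
lemma four_mul_ptVar (a y x : ℝ) :
    4 * (ptVar a y x * (1 - ptVar a y x)) = 1 / Real.cosh (a * (x + y)) ^ 2 := by
  unfold ptVar
  rw [Real.cosh_eq, show 2 * a * (x + y) = a * (x + y) + a * (x + y) by ring, Real.exp_add,
    Real.exp_neg]
  have := Real.exp_pos (a * (x + y))
  field_simp
  ring

lemma tendsto_ptVar {a : ℝ} (ha : 0 < a) (y : ℝ) : Tendsto (ptVar a y) atTop (𝓝 0) := by
  unfold ptVar
  refine Tendsto.const_div_atTop (tendsto_atTop_add_const_left _ 1 ?_) 1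
  refine Real.tendsto_exp_atTop.comp (Tendsto.const_mul_atTop (by positivity) ?_)
  exact tendsto_atTop_add_const_right _ y tendsto_id

/-- The solution decaying like `exp (-κ x)`. -/
def ptSol (a y s κ x : ℝ) : ℝ := Real.exp (-κ * x) * hyperF s (κ / a) (ptVar a y x)

/-- The derivative of `ptSol`. -/
def ptSol' (a y s κ x : ℝ) : ℝ :=
  Real.exp (-κ * x) * (-κ * hyperF s (κ / a) (ptVar a y x) -
    2 * a * (ptVar a y x * (1 - ptVar a y x)) * hyperF' s (κ / a) (ptVar a y x))

lemma hyperF_zero (s k : ℝ) : hyperF s k 0 = 1 := by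
  unfold hyperF
  rw [tsum_eq_single 0 fun n hn => by simp [hn]]
  simp [hyperCoeff]

lemma isDecayingSolution_ptSol {a y s κ : ℝ} (ha : 0 < a) (hy : 0 ≤ y) (hs : 0 ≤ s) (hκ : 0 < κ) :
    IsDecayingSolution (ptCoeff a y s (κ ^ 2)) (ptSol a y s κ) (ptSol' a y s κ) := by
  have hk : 0 ≤ κ / a := by positivity
  have he : ∀ x, HasDerivAt (fun x => Real.exp (-κ * x)) (Real.exp (-κ * x) * (-κ * 1)) x :=
    fun x => ((hasDerivAt_id x).const_mul (-κ)).exp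
  have hF : ∀ x, HasDerivAt (fun x => hyperF s (κ / a) (ptVar a y x)) _ x := fun x =>
    (hasDerivAt_hyperF hs hk (abs_ptVar_lt_one a y x)).comp x (hasDerivAt_ptVar a y x)
  have hF' : ∀ x, HasDerivAt (fun x => hyperF' s (κ / a) (ptVar a y x)) _ x := fun x =>
    (hasDerivAt_hyperF' hs hk (abs_ptVar_lt_one a y x)).comp x (hasDerivAt_ptVar a y x)
  refine ⟨fun x => ?_, fun x => ?_, ?_⟩
  · convert! (he x).mul (hF x) using 1
    unfold ptSol'
    ring
  · have hz := hasDerivAt_ptVar a y x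
    convert! (he x).mul (((hF x).const_mul (-κ)).sub
      (((hz.mul (hz.const_sub 1)).const_mul (2 * a)).mul (hF' x))) using 1
    have h1 := hyperF_ode hs hk (abs_ptVar_lt_one a y x)
    have h2 := four_mul_ptVar a y x
    have h3 : ptCoeff a y s (κ ^ 2) x =
        κ ^ 2 - a ^ 2 * (s * (s + 1)) * (4 * (ptVar a y x * (1 - ptVar a y x))) := by
      rw [h2, ptCoeff]; ring
    rw [h3]
    simp only [Pi.sub_apply, Pi.mul_apply, ptSol]
    obtain ⟨k, hk'⟩ : ∃ k, k = κ / a := ⟨_, rfl⟩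
    have hκ' : κ = k * a := by rw [hk']; field_simp
    rw [← hk'] at h1 ⊢
    rw [hκ']
    -- After the change of variable, the equation is the hypergeometric one multiplied by this
    -- factor.
    linear_combination (-4 * a ^ 2 * Real.exp (-(k * a) * x) *
      (ptVar a y x * (1 - ptVar a y x))) * h1
  -- For `x ≥ 0` and `y ≥ 0` the variable stays in `[0, 1/2]`, a compact subset of the disc of
  -- convergence, so both series are bounded and only the exponential factor matters.
  · have cF : ContinuousOn (hyperF s (κ / a)) (Set.Icc 0 (1 / 2)) := fun z hz =>
      (hasDerivAt_hyperF hs hk (by rw [abs_of_nonneg hz.1]; linarith [hz.2])).continuousAt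
        |>.continuousWithinAt
    have cF' : ContinuousOn (hyperF' s (κ / a)) (Set.Icc 0 (1 / 2)) := fun z hz =>
      (hasDerivAt_hyperF' hs hk (by rw [abs_of_nonneg hz.1]; linarith [hz.2])).continuousAt
        |>.continuousWithinAt
    obtain ⟨A, hA⟩ := isCompact_Icc.exists_bound_of_continuousOn cF
    obtain ⟨B, hB⟩ := isCompact_Icc.exists_bound_of_continuousOn cF'
    have hA0 : 0 ≤ A := (norm_nonneg _).trans (hA 0 (by norm_num))
    have hB0 : 0 ≤ B := (norm_nonneg _).trans (hB 0 (by norm_num))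
    refine ⟨A + (κ * A + 2 * a * B), κ, hκ, fun x hx => ?_⟩
    have z0 := ptVar_pos a y x
    have z1 := ptVar_lt_one a y x
    have hz : ptVar a y x ∈ Set.Icc (0 : ℝ) (1 / 2) := ⟨z0.le, ptVar_le_half (by positivity)⟩
    have a1 := hA _ hz
    have b1 := hB _ hz
    rw [Real.norm_eq_abs] at a1 b1
    have w0 : 0 ≤ ptVar a y x * (1 - ptVar a y x) := by nlinarith
    have w1 : ptVar a y x * (1 - ptVar a y x) ≤ 1 := by nlinarith
    have e0 := Real.exp_pos (-κ * x)
    have hsum : 0 ≤ κ * A + 2 * a * B := by positivity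
    refine ⟨?_, ?_⟩
    · rw [ptSol, abs_mul, abs_of_pos e0, mul_comm]
      exact mul_le_mul_of_nonneg_right (by linarith) e0.le
    · rw [ptSol', abs_mul, abs_of_pos e0, mul_comm]
      refine mul_le_mul_of_nonneg_right ?_ e0.le
      refine (abs_sub _ _).trans ?_
      rw [abs_mul, abs_mul, abs_neg, abs_of_pos hκ,
        abs_of_nonneg (a := 2 * a * _) (by positivity)]
      have : κ * |hyperF s (κ / a) (ptVar a y x)| ≤ κ * A := by gcongr
      have : 2 * a * (ptVar a y x * (1 - ptVar a y x)) * |hyperF' s (κ / a) (ptVar a y x)|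
          ≤ 2 * a * 1 * B := by gcongr
      linarith

/-- The hypergeometric factor tends to `F(0) = 1` at infinity. -/
lemma eventually_ptSol_pos {a y s κ : ℝ} (ha : 0 < a) (hs : 0 ≤ s) (hκ : 0 < κ) :
    ∀ᶠ x in atTop, 0 < ptSol a y s κ x := by
  have hc : ContinuousAt (hyperF s (κ / a)) 0 :=
    (hasDerivAt_hyperF hs (by positivity) (by simp)).continuousAt
  have ht : Tendsto (fun x => hyperF s (κ / a) (ptVar a y x)) atTop (𝓝 1) := by
    have := hc.tendsto.comp (tendsto_ptVar ha y)
    rwa [hyperF_zero] at this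
  filter_upwards [ht.eventually (eventually_gt_nhds one_pos)] with x hx
  exact mul_pos (Real.exp_pos _) hx

lemma continuousOn_hyperCoeff (s : ℝ) (n : ℕ) :
    ContinuousOn (fun k => hyperCoeff s k n) (Set.Ici 0) := by
  induction n with
  | zero => simp only [hyperCoeff]; exact continuousOn_const
  | succ n ih =>
    simp only [hyperCoeff_succ]
    refine ih.mul (continuousOn_const.div (by fun_prop) fun k hk => ?_)
    have : (0 : ℝ) ≤ k := hk
    positivity

lemma continuousOn_powerSeries_param {c : ℝ → ℕ → ℝ} {S : Set ℝ} {M : ℝ} {p : ℕ}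
    (hcont : ∀ n, ContinuousOn (fun k => c k n) S)
    (hc : ∀ k ∈ S, ∀ n, |c k n| ≤ M * ((n : ℝ) + 1) ^ p) {z : ℝ} (h0 : 0 < z) (h1 : z < 1) :
    ContinuousOn (fun k => ∑' n, c k n * z ^ n) S := by
  refine continuousOn_tsum (fun n => (hcont n).mul continuousOn_const)
    ((summable_add_one_pow_mul_geometric p h0 h1).mul_left M) fun n k hk => ?_
  rw [norm_mul, norm_pow, Real.norm_of_nonneg h0.le, Real.norm_eq_abs, ← mul_assoc]
  exact mul_le_mul_of_nonneg_right (hc k hk n) (by positivity)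

lemma continuousOn_hyperF {s z : ℝ} (hs : 0 ≤ s) (h0 : 0 < z) (h1 : z < 1) :
    ContinuousOn (fun k => hyperF s k z) (Set.Ici 0) ∧
      ContinuousOn (fun k => hyperF' s k z) (Set.Ici 0) := by
  obtain ⟨M, hM⟩ := exists_hyperCoeff_bound hs
  have b0 : ∀ k ∈ Set.Ici (0 : ℝ), ∀ n, |hyperCoeff s k n| ≤ M * ((n : ℝ) + 1) ^ 0 :=
    fun k hk n => by simpa using hM k hk n
  exact ⟨continuousOn_powerSeries_param (continuousOn_hyperCoeff s) b0 h0 h1,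
    continuousOn_powerSeries_param
      (fun n => continuousOn_const.mul (continuousOn_hyperCoeff s (n + 1)))
      (fun k hk => abs_derivCoeff_le (b0 k hk)) h0 h1⟩

lemma continuousOn_ptSol {a s : ℝ} (ha : 0 < a) (y : ℝ) (hs : 0 ≤ s) :
    ContinuousOn (fun κ => ptSol a y s κ 0) (Set.Ici 0) ∧
      ContinuousOn (fun κ => ptSol' a y s κ 0) (Set.Ici 0) := by
  obtain ⟨h, h'⟩ := continuousOn_hyperF hs (ptVar_pos a y 0) (ptVar_lt_one a y 0)
  have hk : ContinuousOn (fun κ : ℝ => κ / a) (Set.Ici 0) := by fun_prop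
  have hm : Set.MapsTo (fun κ : ℝ => κ / a) (Set.Ici 0) (Set.Ici 0) := fun κ hκ =>
    div_nonneg hκ ha.le
  have g := h.comp hk hm
  have g' := h'.comp hk hm
  simp only [Function.comp_def] at g g'
  unfold ptSol ptSol'
  simp only [mul_zero, Real.exp_zero, one_mul]
  exact ⟨g, (continuousOn_id.neg.mul g).sub (continuousOn_const.mul g')⟩

/-! ### The threshold solution and the slopes at the origin -/

/-- The function `sinh / cosh ^ s`, a solution of the Pöschl–Teller equation. -/
def ptXi (a y s x : ℝ) : ℝ := Real.sinh (a * (x + y)) * Real.cosh (a * (x + y)) ^ (-s)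

/-- The derivative of `ptXi`. -/
def ptXi' (a y s x : ℝ) : ℝ :=
  a * (Real.cosh (a * (x + y)) ^ (1 - s) -
    s * Real.sinh (a * (x + y)) ^ 2 * Real.cosh (a * (x + y)) ^ (-s - 1))

lemma hasDerivAt_cosh_rpow (a y p x : ℝ) :
    HasDerivAt (fun x => Real.cosh (a * (x + y)) ^ p)
      (p * a * Real.sinh (a * (x + y)) * Real.cosh (a * (x + y)) ^ (p - 1)) x := by
  have h : HasDerivAt (fun x => Real.cosh (a * (x + y))) (Real.sinh (a * (x + y)) * (a * 1)) x :=
    (((hasDerivAt_id x).add_const y).const_mul a).cosh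
  convert! h.rpow_const (p := p) (Or.inl (Real.cosh_pos _).ne') using 1
  ring

lemma hasDerivAt_sinh_affine (a y x : ℝ) :
    HasDerivAt (fun x => Real.sinh (a * (x + y))) (a * Real.cosh (a * (x + y))) x := by
  convert! (((hasDerivAt_id x).add_const y).const_mul a).sinh using 1
  simp only [id]
  ring

lemma cosh_rpow_le {p : ℝ} (hp : p ≤ 0) (θ : ℝ) :
    Real.cosh θ ^ p ≤ 2 ^ (-p) * Real.exp (p * θ) := by
  have h : Real.exp θ / 2 ≤ Real.cosh θ := by
    rw [Real.cosh_eq]; linarith [Real.exp_pos (-θ)]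
  refine (Real.rpow_le_rpow_of_nonpos (by positivity) h hp).trans (le_of_eq ?_)
  rw [Real.div_rpow (Real.exp_pos _).le (by norm_num), ← Real.exp_mul, Real.rpow_neg (by norm_num),
    mul_comm θ p]
  field_simp

lemma isDecayingSolution_ptXi {a y s : ℝ} (ha : 0 < a) (hs : 1 < s) :
    IsDecayingSolution (ptCoeff a y s ((a * (s - 1)) ^ 2)) (ptXi a y s) (ptXi' a y s) := by
  refine ⟨fun x => ?_, fun x => ?_, ?_⟩
  · convert! (hasDerivAt_sinh_affine a y x).mul (hasDerivAt_cosh_rpow a y (-s) x) using 1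
    unfold ptXi'
    rw [show (1 : ℝ) - s = -s + 1 by ring, Real.rpow_add_one (Real.cosh_pos _).ne']
    ring
  · convert! ((hasDerivAt_cosh_rpow a y (1 - s) x).sub
      ((((hasDerivAt_sinh_affine a y x).pow 2).const_mul s).mul
        (hasDerivAt_cosh_rpow a y (-s - 1) x))).const_mul a using 1
    unfold ptCoeff ptXi
    have hc := Real.cosh_pos (a * (x + y))
    have hsq := Real.cosh_sq (a * (x + y))
    simp only [Pi.pow_apply]
    set c := Real.cosh (a * (x + y))
    set S := Real.sinh (a * (x + y))
    rw [show 1 - s - 1 = -s by ring, show -s - 1 - 1 = -s - 2 by ring,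
      Real.rpow_sub hc (-s) 1, Real.rpow_sub hc (-s) 2, Real.rpow_one, Real.rpow_two]
    field_simp
    push_cast
    linear_combination (S * s * (s + 1)) * hsq
  -- The solution is bounded by `cosh ^ (1 - s)` and its derivative by `a (1 + s) cosh ^ (1 - s)`;
  -- the first factor is the sum of these constants, the second comes from `cosh θ ≥ exp θ / 2`.
  · refine ⟨(1 + a * (1 + s)) * (2 ^ (s - 1) * Real.exp (-(s - 1) * (a * y))), (s - 1) * a,
      mul_pos (by linarith) ha, fun x _ => ?_⟩
    have hc := Real.cosh_pos (a * (x + y))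
    have hsq := Real.cosh_sq (a * (x + y))
    have hb := cosh_rpow_le (p := 1 - s) (by linarith) (a * (x + y))
    have hexp : 2 ^ (s - 1) * Real.exp (-(s - 1) * (a * y)) * Real.exp (-((s - 1) * a) * x) =
        2 ^ (-(1 - s)) * Real.exp ((1 - s) * (a * (x + y))) := by
      rw [mul_assoc, ← Real.exp_add]; congr 2 <;> ring
    have hS : |Real.sinh (a * (x + y))| ≤ Real.cosh (a * (x + y)) :=
      abs_le_of_sq_le_sq (by linarith) hc.le
    rw [mul_assoc, hexp]
    have hpos : 0 < Real.cosh (a * (x + y)) ^ (1 - s) := Real.rpow_pos_of_pos hc _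
    have e1 : Real.cosh (a * (x + y)) ^ (1 - s) =
        Real.cosh (a * (x + y)) * Real.cosh (a * (x + y)) ^ (-s) := by
      rw [show (1 : ℝ) - s = -s + 1 by ring, Real.rpow_add_one hc.ne', mul_comm]
    have e2 : Real.cosh (a * (x + y)) ^ (1 - s) =
        Real.cosh (a * (x + y)) ^ 2 * Real.cosh (a * (x + y)) ^ (-s - 1) := by
      rw [show (1 : ℝ) - s = (-s - 1) + 2 by ring, Real.rpow_add hc, Real.rpow_two, mul_comm]
    have hu : |ptXi a y s x| ≤ Real.cosh (a * (x + y)) ^ (1 - s) := by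
      rw [ptXi, abs_mul, abs_of_pos (Real.rpow_pos_of_pos hc (-s)), e1]
      exact mul_le_mul_of_nonneg_right hS (Real.rpow_pos_of_pos hc _).le
    have hv : |ptXi' a y s x| ≤ a * (1 + s) * Real.cosh (a * (x + y)) ^ (1 - s) := by
      have : Real.sinh (a * (x + y)) ^ 2 * Real.cosh (a * (x + y)) ^ (-s - 1) ≤
          Real.cosh (a * (x + y)) ^ (1 - s) := by
        rw [e2]
        exact mul_le_mul_of_nonneg_right (by linarith) (Real.rpow_pos_of_pos hc _).le
      have h0 : 0 ≤ Real.sinh (a * (x + y)) ^ 2 * Real.cosh (a * (x + y)) ^ (-s - 1) :=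
        mul_nonneg (sq_nonneg _) (Real.rpow_pos_of_pos hc _).le
      rw [ptXi', abs_mul, abs_of_pos ha, mul_assoc a]
      refine mul_le_mul_of_nonneg_left (abs_le.2 ⟨?_, ?_⟩) ha.le <;> nlinarith
    have has : 0 ≤ a * (1 + s) := by positivity
    constructor
    · nlinarith
    · nlinarith

lemma ptXi_pos {a y s x : ℝ} (ha : 0 < a) (hy : 0 < y) (hx : 0 ≤ x) : 0 < ptXi a y s x :=
  mul_pos (Real.sinh_pos_iff.2 (by positivity)) (Real.rpow_pos_of_pos (Real.cosh_pos _) _)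

/-- Comparison with the threshold solution, which is positive since `y > 0` and has the smaller
coefficient. -/
lemma ptSol_pos {a y s κ x : ℝ} (ha : 0 < a) (hy : 0 < y) (hs : 1 < s) (hκ : a * (s - 1) < κ)
    (hx : 0 ≤ x) : 0 < ptSol a y s κ x := by
  have h0 : 0 < a * (s - 1) := mul_pos ha (by linarith)
  have hκ0 := h0.trans hκ
  refine (isDecayingSolution_ptSol ha hy.le (by linarith) hκ0).pos_of_eventually_pos
    (isDecayingSolution_ptXi ha hs) (fun x => ?_) (eventually_ptSol_pos ha (by linarith) hκ0)
    (fun x hx => ptXi_pos ha hy hx) x hx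
  unfold ptCoeff
  have : (a * (s - 1)) ^ 2 < κ ^ 2 := by gcongr
  linarith

/-- The decaying solution satisfies the Robin condition `u'(0) + β u(0) = 0` at some energy below
the threshold as soon as `ptXi` has a larger logarithmic derivative at `0`. -/
lemma exists_robin {a y s β : ℝ} (ha : 0 < a) (hy : 0 < y) (hs : 1 < s) (hβ : 0 ≤ β)
    (hξ : 0 < ptXi' a y s 0 + β * ptXi a y s 0) :
    ∃ κ, a * (s - 1) < κ ∧ ptSol' a y s κ 0 + β * ptSol a y s κ 0 = 0 := by
  have h0 : 0 < a * (s - 1) := mul_pos ha (by linarith)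
  have hs0 : 0 ≤ s := by linarith
  -- At the threshold the hypergeometric solution is a positive multiple of `ptXi`, so the sign
  -- assumption transfers.
  have hstart : 0 < ptSol' a y s (a * (s - 1)) 0 + β * ptSol a y s (a * (s - 1)) 0 := by
    obtain ⟨c, hc, e1, e2⟩ := (isDecayingSolution_ptSol ha hy.le hs0 h0).exists_pos_mul
      (isDecayingSolution_ptXi ha hs) (eventually_ptSol_pos ha hs0 h0)
      (fun x hx => ptXi_pos ha hy hx)
    rw [e1, e2]
    nlinarith
  have hP : 0 ≤ a ^ 2 * (s * (s + 1)) := by positivity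
  -- Since `β + 1 ≥ 1`, this `K` satisfies `K ^ 2 ≥ (β + 1) ^ 2 + a ^ 2 * (s * (s + 1))`; the
  -- coefficient is then at least `(β + 1) ^ 2` and the logarithmic slope at most `-(β + 1)`.
  set K := a * (s - 1) + (β + 1) + a ^ 2 * (s * (s + 1)) with hK
  have hK0 : a * (s - 1) < K := by rw [hK]; linarith
  have hend : ptSol' a y s K 0 + β * ptSol a y s K 0 < 0 := by
    have hpos := fun x hx => ptSol_pos (x := x) ha hy hs hK0 hx
    have := (isDecayingSolution_ptSol ha hy.le hs0 (h0.trans hK0)).slope_le_neg (M := β + 1)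
      (by linarith) (fun x _ => ?_) hpos
    · have := hpos 0 le_rfl
      linarith
    · unfold ptCoeff
      have : a ^ 2 * (s * (s + 1)) / Real.cosh (a * (x + y)) ^ 2 ≤ a ^ 2 * (s * (s + 1)) :=
        div_le_self hP (one_le_pow₀ (Real.one_le_cosh _))
      nlinarith
  obtain ⟨c, c'⟩ := continuousOn_ptSol ha y hs0
  have hcont : ContinuousOn (fun κ => ptSol' a y s κ 0 + β * ptSol a y s κ 0)
      (Set.Icc (a * (s - 1)) K) :=
    (c'.add (continuousOn_const.mul c)).mono fun κ hκ => h0.le.trans hκ.1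
  obtain ⟨κ, hκ, e⟩ := intermediate_value_Icc' hK0.le hcont ⟨hend.le, hstart.le⟩
  refine ⟨κ, lt_of_le_of_ne hκ.1 ?_, e⟩
  rintro rfl
  exact hstart.ne' e

/-- The logarithmic derivative of the decaying solution at `0` is strictly decreasing in `κ`. -/
lemma ptSol_slope_lt {a y s κ κ' : ℝ} (ha : 0 < a) (hy : 0 < y) (hs : 1 < s)
    (hκ : a * (s - 1) < κ) (hκκ' : κ < κ') :
    ptSol' a y s κ' 0 * ptSol a y s κ 0 < ptSol a y s κ' 0 * ptSol' a y s κ 0 := by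
  have h0 : 0 < a * (s - 1) := mul_pos ha (by linarith)
  refine (isDecayingSolution_ptSol ha hy.le (by linarith) (by linarith)).slope_lt
    (isDecayingSolution_ptSol ha hy.le (by linarith) (by linarith)) (fun x _ => ?_)
    (fun x hx => ptSol_pos ha hy hs (hκ.trans hκκ') hx.le) (fun x hx => ptSol_pos ha hy hs hκ hx.le)
  unfold ptCoeff
  have : 0 < κ := h0.trans hκ
  have : κ ^ 2 < κ' ^ 2 := by gcongr
  linarith

/-- Sturm comparison with the threshold solution. It excludes even negative eigenvalues when `ptXi'`
is nonpositive at `0`. -/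
lemma ptSol_slope_lt_ptXi {a y s κ : ℝ} (ha : 0 < a) (hy : 0 < y) (hs : 1 < s)
    (hκ : a * (s - 1) < κ) :
    ptSol' a y s κ 0 * ptXi a y s 0 < ptSol a y s κ 0 * ptXi' a y s 0 := by
  have h0 : 0 < a * (s - 1) := mul_pos ha (by linarith)
  refine (isDecayingSolution_ptSol ha hy.le (by linarith) (by linarith)).slope_lt
    (isDecayingSolution_ptXi ha hs) (fun x _ => ?_)
    (fun x hx => ptSol_pos ha hy hs hκ hx.le) (fun x hx => ptXi_pos ha hy hx.le)
  unfold ptCoeff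
  have : (a * (s - 1)) ^ 2 < κ ^ 2 := by gcongr
  linarith

/-- The logarithmic derivative of `ptXi` at `0`. -/
lemma ptXi'_zero {a y s : ℝ} (ha : 0 < a) (hy : 0 < y) :
    ptXi' a y s 0 * Real.tanh (a * y) =
      a * (1 - s * Real.tanh (a * y) ^ 2) * ptXi a y s 0 := by
  have hc := Real.cosh_pos (a * y)
  unfold ptXi ptXi'
  simp only [zero_add]
  rw [Real.tanh_eq_sinh_div_cosh, show (1 : ℝ) - s = -s + 1 by ring,
    Real.rpow_add_one hc.ne', Real.rpow_sub_one hc.ne']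
  field_simp

/-! ### Weak solutions on the half-line -/

/-- Test functions on `(0, ∞)`. -/
structure IsTest (φ : ℝ → ℝ) : Prop where
  contDiff : ContDiff ℝ (⊤ : ℕ∞) φ
  hasCompactSupport : HasCompactSupport φ
  tsupport_subset : tsupport φ ⊆ Set.Ioi 0

namespace IsTest

variable {φ w : ℝ → ℝ}

lemma continuous (h : IsTest φ) : Continuous φ := h.contDiff.continuous

lemma apply_eq_zero (h : IsTest φ) {x : ℝ} (hx : x ≤ 0) : φ x = 0 :=
  image_eq_zero_of_notMem_tsupport fun hx' => (h.tsupport_subset hx').not_ge hx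

lemma of_support (h : IsTest φ) {ψ : ℝ → ℝ} (hψ : ContDiff ℝ (⊤ : ℕ∞) ψ)
    (hsub : Function.support ψ ⊆ Function.support φ) : IsTest ψ :=
  ⟨hψ, h.hasCompactSupport.mono hsub, (closure_mono hsub).trans h.tsupport_subset⟩

lemma deriv (h : IsTest φ) : IsTest (deriv φ) :=
  ⟨(contDiff_infty_iff_deriv.1 h.contDiff).2, h.hasCompactSupport.deriv,
    (closure_minimal support_deriv_subset (isClosed_tsupport φ)).trans h.tsupport_subset⟩

lemma mul (h : IsTest φ) (hw : ContDiff ℝ (⊤ : ℕ∞) w) : IsTest fun x => φ x * w x :=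
  h.of_support (h.contDiff.mul hw) fun _ hx => left_ne_zero_of_mul hx

lemma div (h : IsTest φ) (hw : ContDiff ℝ (⊤ : ℕ∞) w) (hpos : ∀ x, 0 < x → w x ≠ 0) :
    IsTest fun x => φ x / w x := by
  refine h.of_support (contDiff_iff_contDiffAt.2 fun x => ?_) fun x hx => ?_
  · by_cases hx : x ∈ tsupport φ
    · exact h.contDiff.contDiffAt.div hw.contDiffAt (hpos x (h.tsupport_subset hx))
    · have : (fun x => φ x / w x) =ᶠ[𝓝 x] fun _ => 0 := by
        filter_upwards [notMem_tsupport_iff_eventuallyEq.1 hx] with z hz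
        rw [hz, Pi.zero_apply, zero_div]
      exact contDiffAt_const.congr_of_eventuallyEq this
  · rintro h0
    exact hx (by simp [h0])

lemma sub_smul (h : IsTest φ) (hw : IsTest w) (c : ℝ) : IsTest fun x => φ x - c * w x := by
  refine ⟨h.contDiff.sub (contDiff_const.mul hw.contDiff),
    h.hasCompactSupport.sub (hw.hasCompactSupport.mul_left (f := fun _ => c)), ?_⟩
  refine (closure_minimal (fun x hx => ?_)
    ((isClosed_tsupport φ).union (isClosed_tsupport w))).trans
    (Set.union_subset h.tsupport_subset hw.tsupport_subset)
  by_contra hcon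
  rw [Set.mem_union, not_or] at hcon
  refine hx ?_
  simp [image_eq_zero_of_notMem_tsupport hcon.1, image_eq_zero_of_notMem_tsupport hcon.2]

/-- A test function of vanishing integral has a test primitive. -/
lemma exists_primitive (h : IsTest φ) (h0 : ∫ x, φ x = 0) :
    ∃ g, IsTest g ∧ ∀ x, HasDerivAt g (φ x) x := by
  obtain ⟨m, R, hm, hsub⟩ : ∃ m R, 0 < m ∧ tsupport φ ⊆ Set.Icc m R := by
    rcases (tsupport φ).eq_empty_or_nonempty with he | hne
    · exact ⟨1, 1, one_pos, by simp [he]⟩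
    · have hc : IsCompact (tsupport φ) := h.hasCompactSupport
      obtain ⟨m, hm, hm'⟩ := hc.exists_isLeast hne
      obtain ⟨R, hR, hR'⟩ := hc.exists_isGreatest hne
      exact ⟨m, R, h.tsupport_subset hm, fun x hx => ⟨hm' hx, hR' hx⟩⟩
  have hd : ∀ x, HasDerivAt (fun x => ∫ t in (0 : ℝ)..x, φ t) (φ x) x := fun x =>
    intervalIntegral.integral_hasDerivAt_right (h.continuous.intervalIntegrable _ _)
      h.continuous.aestronglyMeasurable.stronglyMeasurableAtFilter h.continuous.continuousAt
  -- Left of `m` the integrand vanishes; right of `R` the integral is the total one, which is zero.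
  have hsupp : Function.support (fun x => ∫ t in (0 : ℝ)..x, φ t) ⊆ Set.Icc m R := by
    intro x hx
    by_contra hcon
    refine hx ?_
    rw [Set.mem_Icc, not_and_or, not_le, not_le] at hcon
    rcases hcon with hxm | hxR
    · refine intervalIntegral.integral_zero_ae (Eventually.of_forall fun t ht => ?_)
      refine image_eq_zero_of_notMem_tsupport fun ht' => ?_
      have h1 := (hsub ht').1
      rcases le_total 0 x with hx0 | hx0
      · rw [Set.uIoc_of_le hx0] at ht
        linarith [ht.2]
      · rw [Set.uIoc_of_ge hx0] at ht
        linarith [ht.2]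
    · simp only
      rw [intervalIntegral.integral_eq_integral_of_support_subset, h0]
      intro t ht
      have := hsub (subset_tsupport φ ht)
      exact ⟨hm.trans_le this.1, this.2.trans hxR.le⟩
  refine ⟨_, ⟨?_, HasCompactSupport.of_support_subset_isCompact isCompact_Icc hsupp, ?_⟩, hd⟩
  · rw [contDiff_infty_iff_deriv]
    refine ⟨fun x => (hd x).differentiableAt, ?_⟩
    rw [show _root_.deriv (fun x => ∫ t in (0 : ℝ)..x, φ t) = φ from funext fun x => (hd x).deriv]
    exact h.contDiff
  · exact (closure_minimal hsupp isClosed_Icc).trans fun x hx => hm.trans_le hx.1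

lemma integrable_smul (h : IsTest φ) {f : ℝ → ℂ} (hf : LocallyIntegrable f) :
    Integrable fun x => φ x • f x :=
  hf.integrable_smul_left_of_hasCompactSupport h.continuous h.hasCompactSupport

end IsTest

lemma exists_isTest : ∃ φ, IsTest φ ∧ (∀ x, 0 ≤ φ x) ∧ φ 1 = 1 := by
  obtain ⟨φ, h1, h2, h3, h4, h5⟩ := exists_contDiff_tsupport_subset (n := ⊤)
    (Ioi_mem_nhds (zero_lt_one : (0 : ℝ) < 1))
  exact ⟨φ, ⟨h3, h2, h1⟩, fun x => (h4 ⟨x, rfl⟩).1, h5⟩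

/-- A weighted du Bois-Reymond lemma: `(f / w)' = 0` on `(0, ∞)` in the weak sense. -/
lemma ae_eq_const_mul_of_weak {f : ℝ → ℂ} {w : ℝ → ℝ} (hf : LocallyIntegrable f)
    (hw : ContDiff ℝ (⊤ : ℕ∞) w) (hpos : ∀ x, 0 < x → 0 < w x)
    (hweak : ∀ φ, IsTest φ → ∫ x, (deriv φ x / w x) • f x = 0) :
    ∃ c : ℂ, ∀ᵐ x, 0 < x → f x = w x • c := by
  obtain ⟨η, hη, hη0, hη1⟩ := exists_isTest
  have hηw := hη.mul hw
  have hA : 0 < ∫ x, η x * w x := by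
    refine hηw.continuous.integral_pos_of_hasCompactSupport_nonneg_nonzero
      hηw.hasCompactSupport (fun x => ?_) (x := 1) ?_
    · rcases le_or_gt x 0 with hx | hx
      · simp [hη.apply_eq_zero hx]
      · exact mul_nonneg (hη0 x) (hpos x hx).le
    · rw [hη1, one_mul]
      exact (hpos 1 one_pos).ne'
  set A := ∫ x, η x * w x
  set B := ∫ x, η x • f x
  -- If `f = w c` on `(0, ∞)`, testing against `η` gives `B = A c`, which dictates the constant.
  refine ⟨A⁻¹ • B, ?_⟩
  have hwc : LocallyIntegrable fun x => w x • (A⁻¹ • B) :=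
    (hw.continuous.smul continuous_const).locallyIntegrable
  have hloc : LocallyIntegrable fun x => f x - w x • (A⁻¹ • B) := hf.sub hwc
  have key := IsOpen.ae_eq_zero_of_integral_contDiff_smul_eq_zero (μ := (volume : Measure ℝ))
    isOpen_Ioi (hloc.locallyIntegrableOn (Set.Ioi 0)) (fun φ h1 h2 h3 => ?_)
  · filter_upwards [key] with x hx hx0
    exact sub_eq_zero.1 (hx hx0)
  · have hφ : IsTest φ := ⟨h1, h2, h3⟩
    have hφw := hφ.mul hw
    -- The multiple of `η w` is chosen to cancel the integral of `φ w`, so that the difference is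
    -- the derivative of an admissible test function.
    have hg := hφw.sub_smul hηw ((∫ x, φ x * w x) / A)
    obtain ⟨g, hgt, hgd⟩ := hg.exists_primitive (by
      rw [integral_sub (hφw.continuous.integrable_of_hasCompactSupport hφw.hasCompactSupport)
        ((hηw.continuous.integrable_of_hasCompactSupport hηw.hasCompactSupport).const_mul _),
        integral_const_mul]
      field_simp
      ring)
    have h0 := hweak g hgt
    have e : ∀ x, (deriv g x / w x) • f x =
        φ x • f x - ((∫ x, φ x * w x) / A) • (η x • f x) := by
      intro x
      rw [(hgd x).deriv, smul_smul, ← sub_smul]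
      congr 1
      rcases le_or_gt x 0 with hx | hx
      · simp [hη.apply_eq_zero hx, hφ.apply_eq_zero hx]
      · have := hpos x hx
        field_simp
    simp only [e] at h0
    have hi : Integrable fun x => ((∫ x, φ x * w x) / A) • (η x • f x) :=
      Integrable.smul ((∫ x, φ x * w x) / A) (hη.integrable_smul hf)
    rw [integral_sub (hφ.integrable_smul hf) hi, integral_smul] at h0
    simp only [smul_sub]
    rw [integral_sub (hφ.integrable_smul hf) (hφ.integrable_smul hwc), sub_eq_zero.1 h0]
    simp only [smul_smul, ← mul_assoc]
    rw [integral_smul_const, integral_mul_const, div_eq_mul_inv, sub_eq_zero]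

/-- Weak derivative on `(0, ∞)`. -/
def HasWeakDerivPos (f g : ℝ → ℂ) : Prop :=
  ∀ φ : ℝ → ℝ, IsTest φ → ∫ x, deriv φ x • f x = -∫ x, φ x • g x

/-- Weak `L²` solutions on the half-line are multiples of a positive decaying solution. -/
lemma exists_ae_eq_mul_of_weak {Q u v : ℝ → ℝ} (h : IsDecayingSolution Q u v)
    (hQ : ContDiff ℝ (⊤ : ℕ∞) Q) (hpos : ∀ x, 0 ≤ x → 0 < u x) {f f₁ f₂ : ℝ → ℂ}
    (hf : MemLp f 2) (hf₁ : MemLp f₁ 2) (w₁ : HasWeakDerivPos f f₁)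
    (w₂ : HasWeakDerivPos f₁ f₂) (heq : ∀ᵐ x, 0 < x → f₂ x = Q x • f x) :
    ∃ c : ℂ, ∀ᵐ x, 0 < x → f x = u x • c ∧ f₁ x = v x • c := by
  have lf : LocallyIntegrable f := hf.locallyIntegrable (by norm_num)
  have lf₁ : LocallyIntegrable f₁ := hf₁.locallyIntegrable (by norm_num)
  obtain ⟨su, sv⟩ := h.contDiff hQ
  have lF : LocallyIntegrable fun x => u x • f₁ x - v x • f x :=
    (lf₁.continuous_smul h.continuous).sub (lf.continuous_smul h.continuous_deriv)
  have e2 : ∀ φ, IsTest φ → ∫ x, φ x • f₂ x = ∫ x, (φ x * Q x) • f x := fun φ hφ => by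
    refine integral_congr_ae ?_
    filter_upwards [heq] with x hx
    rcases le_or_gt x 0 with hx0 | hx0
    · simp [hφ.apply_eq_zero hx0]
    · rw [hx hx0, smul_smul]
  -- The Wronskian of `u` and `f` has zero weak derivative: test the equation for `f₁` with `φ u`
  -- and that for `f` with `φ v`. The division by `1` is the weight `w = 1`.
  have step1 : ∀ φ, IsTest φ → ∫ x, (deriv φ x / 1) • (u x • f₁ x - v x • f x) = 0 := by
    intro φ hφ
    have hd : ∀ x, HasDerivAt φ (deriv φ x) x := fun x =>
      ((contDiff_infty_iff_deriv.1 hφ.contDiff).1 x).hasDerivAt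
    have hφu := hφ.mul su
    have hφv := hφ.mul sv
    have du : deriv (fun x => φ x * u x) = fun x => deriv φ x * u x + φ x * v x :=
      funext fun x => ((hd x).mul (h.hasDerivAt x)).deriv
    have dv : deriv (fun x => φ x * v x) = fun x => deriv φ x * v x + φ x * (Q x * u x) :=
      funext fun x => ((hd x).mul (h.hasDerivAt_deriv x)).deriv
    have i1 := w₂ _ hφu
    have i2 := w₁ _ hφv
    rw [e2 _ hφu] at i1
    simp only [du] at i1
    simp only [dv] at i2
    have a1 := (hφ.deriv.mul su).integrable_smul lf₁
    have a2 := hφv.integrable_smul lf₁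
    have a3 := (hφ.deriv.mul sv).integrable_smul lf
    have a4 := (hφ.mul (hQ.mul su)).integrable_smul lf
    simp only [add_smul] at i1 i2
    rw [integral_add a1 a2] at i1
    rw [integral_add a3 a4] at i2
    have e : ∀ x, (deriv φ x / 1) • (u x • f₁ x - v x • f x) =
        (deriv φ x * u x) • f₁ x - (deriv φ x * v x) • f x := fun x => by
      rw [div_one, smul_sub, smul_smul, smul_smul]
    simp only [e]
    rw [integral_sub a1 a3]
    have e' : ∫ x, (φ x * u x * Q x) • f x = ∫ x, (φ x * (Q x * u x)) • f x := by
      congr 1; ext1 x; congr 1; ring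
    rw [e'] at i1
    linear_combination i1 - i2
  obtain ⟨c, hc⟩ := ae_eq_const_mul_of_weak lF contDiff_const (fun _ _ => one_pos) step1
  -- As `u` and `v` are bounded on the half-line, the constant Wronskian lies in `L²(0, ∞)`, which
  -- has infinite measure.
  have hc0 : c = 0 := by
    obtain ⟨C, κ, hκ, hb⟩ := h.bound
    have hC : 0 ≤ C := by simpa using (abs_nonneg _).trans (hb 0 le_rfl).1
    have hb' : ∀ x, 0 ≤ x → |u x| ≤ C ∧ |v x| ≤ C := fun x hx => by
      have : C * Real.exp (-κ * x) ≤ C :=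
        mul_le_of_le_one_right hC (Real.exp_le_one_iff.2 (by nlinarith))
      exact ⟨(hb x hx).1.trans this, (hb x hx).2.trans this⟩
    have m1 : MemLp (fun x => u x • f₁ x) 2 (volume.restrict (Set.Ioi 0)) := by
      refine (hf₁.restrict _).of_le_mul (c := C)
        (h.continuous.aestronglyMeasurable.smul hf₁.1.restrict) ?_
      filter_upwards [ae_restrict_mem measurableSet_Ioi] with x hx
      rw [norm_smul]
      exact mul_le_mul_of_nonneg_right (hb' x (le_of_lt hx)).1 (norm_nonneg _)
    have m2 : MemLp (fun x => v x • f x) 2 (volume.restrict (Set.Ioi 0)) := by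
      refine (hf.restrict _).of_le_mul (c := C)
        (h.continuous_deriv.aestronglyMeasurable.smul hf.1.restrict) ?_
      filter_upwards [ae_restrict_mem measurableSet_Ioi] with x hx
      rw [norm_smul]
      exact mul_le_mul_of_nonneg_right (hb' x (le_of_lt hx)).2 (norm_nonneg _)
    have m3 : MemLp (fun _ : ℝ => c) 2 (volume.restrict (Set.Ioi (0 : ℝ))) := by
      refine (m1.sub m2).ae_eq ?_
      filter_upwards [ae_restrict_mem measurableSet_Ioi, ae_restrict_of_ae hc] with x hx hcx
      simpa using hcx hx
    rw [memLp_const_iff (by norm_num) (by norm_num)] at m3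
    simpa using m3
  have hF : ∀ᵐ x, 0 < x → u x • f₁ x = v x • f x := by
    filter_upwards [hc] with x hx hx0
    have := hx hx0
    rw [hc0, smul_zero] at this
    exact sub_eq_zero.1 this
  -- Now `u f₁ = v f` says that `f / u` has zero weak derivative; the test function is `φ / u`.
  obtain ⟨d, hd⟩ := ae_eq_const_mul_of_weak lf su (fun x hx => hpos x hx.le) fun φ hφ => by
    have hne : ∀ x, 0 < x → u x ≠ 0 := fun x hx => (hpos x hx.le).ne'
    have hφu := hφ.div su hne
    have hdu : ∀ x, 0 < x → deriv (fun x => φ x / u x) x =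
        deriv φ x / u x - φ x / u x / u x * v x := fun x hx => by
      have hd : HasDerivAt φ (deriv φ x) x :=
        ((contDiff_infty_iff_deriv.1 hφ.contDiff).1 x).hasDerivAt
      have := hne x hx
      have hq : HasDerivAt (fun x => φ x / u x) _ x := hd.div (h.hasDerivAt x) this
      rw [hq.deriv]
      field_simp
    have hw := w₁ _ hφu
    have e : ∀ᵐ x, (deriv φ x / u x) • f x =
        deriv (fun x => φ x / u x) x • f x + (φ x / u x) • f₁ x := by
      filter_upwards [hF] with x hx
      rcases le_or_gt x 0 with hx0 | hx0
      · simp [hφ.apply_eq_zero hx0, hφ.deriv.apply_eq_zero hx0, hφu.deriv.apply_eq_zero hx0]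
      · have hu := hne x hx0
        rw [hdu x hx0, sub_smul, mul_smul, ← hx hx0, smul_smul (φ x / u x / u x),
          div_mul_cancel₀ _ hu, sub_add_cancel]
    rw [integral_congr_ae e, integral_add (hφu.deriv.integrable_smul lf)
      (hφu.integrable_smul lf₁), hw, neg_add_cancel]
  refine ⟨d, ?_⟩
  filter_upwards [hd, hF] with x hx hFx hx0
  refine ⟨hx hx0, ?_⟩
  have h1 := hFx hx0
  rw [hx hx0, smul_comm (v x)] at h1
  exact smul_right_injective ℂ (hpos x hx0.le).ne' h1

/-! ### Gluing half-line solutions -/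

lemma HasWeakDeriv.pos {f g : ℝ → ℂ} (h : HasWeakDeriv f g) : HasWeakDerivPos f g :=
  fun φ hφ => h φ hφ.contDiff hφ.hasCompactSupport
    (hφ.tsupport_subset.trans fun _ hx => ne_of_gt hx)

lemma HasWeakDeriv.reflect {f g : ℝ → ℂ} (h : HasWeakDeriv f g) :
    HasWeakDerivPos (fun x => f (-x)) (fun x => -g (-x)) := by
  intro φ hφ
  have hsub : tsupport (fun x => φ (-x)) ⊆ {0}ᶜ := by
    have h1 : tsupport (fun x => φ (-x)) ⊆ Neg.neg ⁻¹' tsupport φ :=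
      closure_minimal (fun x hx => subset_tsupport φ hx)
        ((isClosed_tsupport φ).preimage continuous_neg)
    intro x hx h0
    have := hφ.tsupport_subset (h1 hx)
    rw [Set.mem_singleton_iff] at h0
    simp [h0] at this
  have key := h (fun x => φ (-x)) (hφ.contDiff.comp contDiff_neg)
    (hφ.hasCompactSupport.comp_homeomorph (Homeomorph.neg ℝ)) hsub
  have e1 : ∫ x, deriv φ x • f (-x) = ∫ x, deriv φ (-x) • f x := by
    rw [← integral_neg_eq_self]; simp
  have e2 : ∫ x, φ x • -g (-x) = ∫ x, φ (-x) • -g x := by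
    rw [← integral_neg_eq_self]; simp
  rw [e1, e2]
  simp only [deriv_comp_neg, neg_smul, smul_neg, integral_neg, neg_inj] at key ⊢
  rw [key, neg_neg]

lemma ae_neg {p : ℝ → Prop} (h : ∀ᵐ x : ℝ, p x) : ∀ᵐ x : ℝ, p (-x) :=
  (Measure.measurePreserving_neg (volume : Measure ℝ)).quasiMeasurePreserving.ae h

/-- The extension by zero of a function on `(0, ∞)`. -/
def halfExt (u : ℝ → ℝ) : ℝ → ℂ := (Set.Ioi 0).indicator fun x => (u x : ℂ)

/-- The function equal to `u` on `(0, ∞)` and to `σ u(-x)` on `(-∞, 0)`. -/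
def glue (σ : ℂ) (u : ℝ → ℝ) (x : ℝ) : ℂ := halfExt u x + σ * halfExt u (-x)

lemma glue_of_pos (σ : ℂ) (u : ℝ → ℝ) {x : ℝ} (hx : 0 < x) : glue σ u x = u x := by
  simp [glue, halfExt, hx, hx.le]

lemma glue_of_neg (σ : ℂ) (u : ℝ → ℝ) {x : ℝ} (hx : x < 0) : glue σ u x = σ * u (-x) := by
  simp [glue, halfExt, hx, hx.le]

lemma memLp_halfExt {u : ℝ → ℝ} {C κ : ℝ} (hu : Continuous u) (hκ : 0 < κ)
    (hb : ∀ x, 0 ≤ x → |u x| ≤ C * Real.exp (-κ * x)) : MemLp (halfExt u) 2 := by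
  rw [halfExt, memLp_indicator_iff_restrict measurableSet_Ioi]
  have he : MemLp (fun x : ℝ => Real.exp (-κ * x)) 2 (volume.restrict (Set.Ioi 0)) := by
    rw [memLp_two_iff_integrable_sq (by fun_prop)]
    refine (integrableOn_exp_mul_Ioi (a := -κ + -κ) (by linarith) 0).congr
      (Eventually.of_forall fun x => ?_)
    simp only
    rw [sq, ← Real.exp_add]; ring_nf
  refine he.of_le_mul (c := C) (Complex.continuous_ofReal.comp hu).aestronglyMeasurable ?_
  filter_upwards [ae_restrict_mem measurableSet_Ioi] with x hx
  rw [Complex.norm_real, Real.norm_eq_abs, Real.norm_of_nonneg (Real.exp_pos _).le]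
  exact hb x (le_of_lt hx)

lemma memLp_glue {u : ℝ → ℝ} {C κ : ℝ} (σ : ℂ) (hu : Continuous u) (hκ : 0 < κ)
    (hb : ∀ x, 0 ≤ x → |u x| ≤ C * Real.exp (-κ * x)) : MemLp (glue σ u) 2 := by
  have h := memLp_halfExt hu hκ hb
  exact h.add ((h.comp_measurePreserving
    (Measure.measurePreserving_neg (volume : Measure ℝ))).const_mul σ)

lemma locallyIntegrable_glue {u : ℝ → ℝ} (σ : ℂ) (hu : Continuous u) :
    LocallyIntegrable (glue σ u) := by
  have h1 : LocallyIntegrable (halfExt u) :=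
    (Complex.continuous_ofReal.comp hu).locallyIntegrable.indicator measurableSet_Ioi
  have h2 : LocallyIntegrable fun x => σ * halfExt u (-x) := by
    have : (fun x => σ * halfExt u (-x)) =
        (Set.Iio 0).indicator fun x => σ * (u (-x) : ℂ) := by
      ext x
      by_cases hx : x < 0 <;> simp [halfExt, hx]
    rw [this]
    exact Continuous.locallyIntegrable (by fun_prop) |>.indicator measurableSet_Iio
  exact h1.add h2

/-- Reflection reverses the sign of the derivative, hence `-σ`. The jump at `0` is invisible because
test functions vanish near `0`. -/
lemma hasWeakDeriv_glue {u v : ℝ → ℝ} (σ : ℂ) (huv : ∀ x, HasDerivAt u (v x) x)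
    (hv : Continuous v) : HasWeakDeriv (glue σ u) (glue (-σ) v) := by
  intro φ h1 h2 h3
  have hu : Continuous u := continuous_iff_continuousAt.2 fun x => (huv x).continuousAt
  have lu := locallyIntegrable_glue σ hu
  have lv := locallyIntegrable_glue (-σ) hv
  have hd : Differentiable ℝ φ := (contDiff_infty_iff_deriv.1 h1).1
  have cd : Continuous (deriv φ) := h1.continuous_deriv (by simp)
  have hglue : ∀ x, x ≠ 0 → HasDerivAt (glue σ u) (glue (-σ) v x) x := by
    intro x hx
    rcases lt_or_gt_of_ne hx with hx | hx
    · rw [glue_of_neg _ _ hx]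
      have hn : HasDerivAt (fun x => u (-x)) (v (-x) * -1) x :=
        (huv (-x)).comp x (hasDerivAt_neg x)
      have := (hn.ofReal_comp.const_mul σ).congr_of_eventuallyEq
        (f₁ := glue σ u) ((eventually_lt_nhds hx).mono fun z hz => glue_of_neg _ _ hz)
      convert! this using 1
      push_cast; ring
    · rw [glue_of_pos _ _ hx]
      exact (huv x).ofReal_comp.congr_of_eventuallyEq
        ((eventually_gt_nhds hx).mono fun z hz => glue_of_pos _ _ hz)
  have i1 := lv.integrable_smul_left_of_hasCompactSupport h1.continuous h2
  have i2 := lu.integrable_smul_left_of_hasCompactSupport cd h2.deriv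
  have i3 := lu.integrable_smul_left_of_hasCompactSupport h1.continuous h2
  have hts : tsupport (fun x => (φ x : ℂ)) ⊆ tsupport φ :=
    closure_mono fun x hx => by simpa using hx
  have key := integral_mul_deriv_eq_deriv_mul_of_integrable (u := fun x => (φ x : ℂ))
    (u' := fun x => ((deriv φ x : ℝ) : ℂ)) (v := glue σ u) (v' := glue (-σ) v)
    (fun x _ => (hd x).hasDerivAt.ofReal_comp) (fun x hx => hglue x (h3 (hts hx)))
    (by simpa only [Complex.real_smul] using! i1) (by simpa only [Complex.real_smul] using! i2)
    (by simpa only [Complex.real_smul] using! i3)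
  simp only [Complex.real_smul]
  rw [key, neg_neg]

lemma traceRight_glue {u : ℝ → ℝ} (σ : ℂ) (hu : Continuous u) :
    TraceRight (glue σ u) (u 0) := by
  have h : Tendsto (fun x => (u x : ℂ)) (𝓝[>] 0) (𝓝 (u 0 : ℂ)) :=
    (Complex.continuous_ofReal.comp hu).continuousAt.mono_left nhdsWithin_le_nhds
  refine (h.congr' ?_).mono_left inf_le_left
  filter_upwards [self_mem_nhdsWithin] with x hx using (glue_of_pos σ u hx).symm

lemma traceLeft_glue {u : ℝ → ℝ} (σ : ℂ) (hu : Continuous u) :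
    TraceLeft (glue σ u) (σ * u 0) := by
  have hc : Continuous fun x => σ * (u (-x) : ℂ) := by fun_prop
  have h : Tendsto (fun x => σ * (u (-x) : ℂ)) (𝓝[<] 0) (𝓝 (σ * (u (-0) : ℂ))) :=
    hc.continuousAt.mono_left nhdsWithin_le_nhds
  rw [neg_zero] at h
  refine (h.congr' ?_).mono_left inf_le_left
  filter_upwards [self_mem_nhdsWithin] with x hx using (glue_of_neg σ u hx).symm

/-- A set of positive measure meets every conull set. This makes essential one-sided limits unique.
-/
lemma neBot_inf_ae {l : Filter ℝ} (h : ∀ s ∈ l, volume s ≠ 0) :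
    (l ⊓ ae (volume : Measure ℝ)).NeBot := by
  rw [inf_neBot_iff]
  intro s hs t ht
  by_contra hcon
  rw [Set.not_nonempty_iff_eq_empty] at hcon
  have hsub : s ⊆ tᶜ := fun x hx hxt => by
    have : x ∈ s ∩ t := ⟨hx, hxt⟩
    simp [hcon] at this
  exact h s hs (measure_mono_null hsub (mem_ae_iff.1 ht))

instance neBot_right : (𝓝[>] (0 : ℝ) ⊓ ae volume).NeBot := neBot_inf_ae fun s hs => by
  obtain ⟨b, hb, hsub⟩ := mem_nhdsGT_iff_exists_Ioo_subset.1 hs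
  have : 0 < volume (Set.Ioo 0 b) := by simpa using hb
  exact (this.trans_le (measure_mono hsub)).ne'

instance neBot_left : (𝓝[<] (0 : ℝ) ⊓ ae volume).NeBot := neBot_inf_ae fun s hs => by
  obtain ⟨b, hb, hsub⟩ := mem_nhdsLT_iff_exists_Ioo_subset.1 hs
  have : 0 < volume (Set.Ioo b 0) := by simpa using hb
  exact (this.trans_le (measure_mono hsub)).ne'

lemma TraceRight.eq_of_ae {f : ℝ → ℂ} {u : ℝ → ℝ} {a c : ℂ} (h : TraceRight f a)
    (hu : Continuous u) (hf : ∀ᵐ x, 0 < x → f x = u x • c) : a = u 0 * c := by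
  have h' : TraceRight (fun x => glue 1 u x * c) (u 0 * c) := (traceRight_glue 1 hu).mul_const c
  refine tendsto_nhds_unique (h.congr' ?_) h'
  filter_upwards [hf.filter_mono inf_le_right,
    mem_inf_of_left (self_mem_nhdsWithin : Set.Ioi (0 : ℝ) ∈ 𝓝[>] 0)] with x hx hx0
  rw [hx hx0, glue_of_pos 1 u hx0, Complex.real_smul]

lemma TraceLeft.eq_of_ae {f : ℝ → ℂ} {u : ℝ → ℝ} {a c : ℂ} (h : TraceLeft f a)
    (hu : Continuous u) (hf : ∀ᵐ x, x < 0 → f x = u (-x) • c) : a = u 0 * c := by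
  have h' : TraceLeft (fun x => glue 1 u x * c) (1 * u 0 * c) := (traceLeft_glue 1 hu).mul_const c
  rw [one_mul] at h'
  refine tendsto_nhds_unique (h.congr' ?_) h'
  filter_upwards [hf.filter_mono inf_le_right,
    mem_inf_of_left (self_mem_nhdsWithin : Set.Iio (0 : ℝ) ∈ 𝓝[<] 0)] with x hx hx0
  rw [hx hx0, glue_of_neg 1 u hx0, Complex.real_smul, one_mul]

/-! ### Eigenspaces of `L₁` -/

lemma mem_eigenspace_L1sym {γ μ ω y : ℝ} {z : ℂ} {ψ : L2R} :
    ψ ∈ eigenspace (L1sym γ μ ω y) z ↔ ∃ ψ₁ ψ₂ : L2R, IsDomainElement γ ψ ψ₁ ψ₂ ∧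
      ψ₂ = ((ω : ℂ) - z) • ψ - mulSymPotential μ ω y ψ := by
  have hg : ∀ p : L2R × L2R, p ∈ (hamiltonian γ).graph ↔
      ∃ ψ₁ ψ₂ : L2R, IsDomainElement γ p.1 ψ₁ ψ₂ ∧ p.2 = -ψ₂ := fun p => by
    rw [hamiltonian_graph]; rfl
  unfold eigenspace
  rw [Submodule.mem_map]
  constructor
  · rintro ⟨x, hx, rfl⟩
    have hmem := (hamiltonian γ).mem_graph x
    obtain ⟨ψ₁, ψ₂, hd, he⟩ := (hg _).1 hmem
    refine ⟨ψ₁, ψ₂, hd, ?_⟩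
    have h1 : L1sym γ μ ω y x = z • (x : L2R) := by
      simpa [sub_eq_zero] using hx
    have h2 : L1sym γ μ ω y x = ((ω : ℂ) • (x : L2R) - mulSymPotential μ ω y x) +
        hamiltonian γ x := rfl
    simp only at he
    rw [h2, he] at h1
    rw [Submodule.subtype_apply, sub_smul, ← h1]
    abel
  · rintro ⟨ψ₁, ψ₂, hd, he⟩
    obtain ⟨x, hx1, hx2⟩ := ((hamiltonian γ).mem_graph_iff).1
      ((hg (ψ, -ψ₂)).2 ⟨ψ₁, ψ₂, hd, rfl⟩)
    simp only at hx1 hx2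
    refine ⟨x, ?_, hx1⟩
    have h2 : L1sym γ μ ω y x = ((ω : ℂ) • (x : L2R) - mulSymPotential μ ω y x) +
        hamiltonian γ x := rfl
    have h1 : L1sym γ μ ω y x = z • (x : L2R) := by
      rw [h2, hx2, hx1, he, sub_smul]
      abel
    exact sub_eq_zero.2 h1

lemma kernel_eq_eigenspace {E : Type*} [AddCommGroup E] [Module ℂ E] (T : E →ₗ.[ℂ] E) :
    kernel T = eigenspace T 0 := by
  simp [kernel, eigenspace]

lemma coeFn_mulSymPotential (μ ω y : ℝ) (ψ : L2R) :
    mulSymPotential μ ω y ψ =ᵐ[volume] fun x => (symPotential μ ω y x : ℂ) * ψ x :=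
  MemLp.coeFn_toLp (memLp_symPotential_mul μ ω y ψ)

/-- The identity behind the parameters: `(μ√ω)² (1 + 1/μ) (2 + 1/μ) = ω (μ + 1) (2μ + 1)`. -/
lemma sub_symPotential_eq {μ ω y E x : ℝ} (hμ : 0 < μ) (hω : 0 < ω) :
    E - symPotential μ ω y x = ptCoeff (μ * √ω) y (1 + 1 / μ) E |x| := by
  unfold symPotential ptCoeff
  rw [mul_pow, Real.sq_sqrt hω.le]
  congr 2
  field_simp
  ring

lemma symPotential_neg (μ ω y x : ℝ) : symPotential μ ω y (-x) = symPotential μ ω y x := by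
  simp [symPotential]

lemma coeFn_second_deriv {μ ω y z : ℝ} (ψ : L2R) :
    (((ω : ℂ) - z) • ψ - mulSymPotential μ ω y ψ : L2R) =ᵐ[volume]
      fun x => (ω - z - symPotential μ ω y x) • ψ x := by
  filter_upwards [Lp.coeFn_sub (((ω : ℂ) - z) • ψ) (mulSymPotential μ ω y ψ),
    Lp.coeFn_smul ((ω : ℂ) - z) ψ, coeFn_mulSymPotential μ ω y ψ] with x h1 h2 h3
  rw [h1, Pi.sub_apply, h2, h3, Pi.smul_apply, Complex.real_smul, smul_eq_mul]
  push_cast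
  ring

lemma ae_ne_zero : ∀ᵐ x : ℝ, x ≠ 0 :=
  compl_mem_ae_iff.2 (measure_singleton (0 : ℝ))

section Eigenspace

variable {γ μ ω y ν : ℝ} {u v : ℝ → ℝ}

/-- Half-line uniqueness, applied to `ψ` and to its reflection, reduces the eigenvalue problem to a
linear system of two equations in the two amplitudes. -/
lemma exists_coeff_of_mem_eigenspace (hμ : 0 < μ) (hω : 0 < ω)
    (h : IsDecayingSolution (ptCoeff (μ * √ω) y (1 + 1 / μ) (ω - ν)) u v)
    (hpos : ∀ x, 0 ≤ x → 0 < u x) {ψ : L2R} (hψ : ψ ∈ eigenspace (L1sym γ μ ω y) ν) :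
    ∃ c d : ℂ, (∀ᵐ x, 0 < x → ψ x = u x • c) ∧ (∀ᵐ x, x < 0 → ψ x = u (-x) • d) ∧
      (v 0 : ℂ) * c = -(v 0 * d) ∧ u 0 * c - u 0 * d = -(γ : ℂ) * (v 0 * c) := by
  obtain ⟨ψ₁, ψ₂, hd, he⟩ := mem_eigenspace_L1sym.1 hψ
  have hQ := contDiff_ptCoeff (μ * √ω) y (1 + 1 / μ) (ω - ν)
  have h2 : ∀ᵐ x, ψ₂ x = (ω - ν - symPotential μ ω y x) • ψ x := by
    rw [he]; exact coeFn_second_deriv ψ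
  obtain ⟨c, hc⟩ := exists_ae_eq_mul_of_weak h hQ hpos (Lp.memLp ψ) (Lp.memLp ψ₁)
    hd.weakDeriv_one.pos hd.weakDeriv_two.pos (by
      filter_upwards [h2] with x hx hx0
      rw [hx, sub_symPotential_eq hμ hω, abs_of_pos hx0])
  have hmp := Measure.measurePreserving_neg (volume : Measure ℝ)
  have w2 : HasWeakDerivPos (fun x => -ψ₁ (-x)) fun x => ψ₂ (-x) := fun φ hφ => by
    have := hd.weakDeriv_two.reflect φ hφ
    simp only [smul_neg, integral_neg, neg_neg] at this ⊢
    rw [this]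
  obtain ⟨d, hd'⟩ := exists_ae_eq_mul_of_weak h hQ hpos
    ((Lp.memLp ψ).comp_measurePreserving hmp) ((Lp.memLp ψ₁).comp_measurePreserving hmp).neg
    hd.weakDeriv_one.reflect w2 (by
      filter_upwards [ae_neg h2] with x hx hx0
      rw [hx, symPotential_neg, sub_symPotential_eq hμ hω, abs_of_pos hx0]
      rfl)
  have hd'' := ae_neg hd'
  simp only [Function.comp_def, Pi.neg_apply, neg_neg, Left.neg_pos_iff] at hd''
  have c0 := hc.mono fun x hx hx0 => (hx hx0).1
  have c1 := hc.mono fun x hx hx0 => (hx hx0).2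
  have d0 : ∀ᵐ x, x < 0 → ψ x = u (-x) • d := hd''.mono fun x hx hx0 => (hx hx0).1
  have d1 : ∀ᵐ x, x < 0 → ψ₁ x = v (-x) • (-d) := hd''.mono fun x hx hx0 => by
    rw [smul_neg, ← (hx hx0).2, neg_neg]
  obtain ⟨α, β, δ, t1, t2, t3, t4, hj⟩ := hd.boundary
  have e1 := t1.eq_of_ae h.continuous c0
  have e2 := t2.eq_of_ae h.continuous d0
  have e3 := t3.eq_of_ae h.continuous_deriv c1
  have e4 := t4.eq_of_ae h.continuous_deriv d1
  refine ⟨c, d, c0, d0, ?_, ?_⟩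
  · rw [← e3, e4, mul_neg]
  · rw [← e1, ← e2, ← e3, hj]

lemma toLp_glue_mem_eigenspace (hμ : 0 < μ) (hω : 0 < ω)
    (h : IsDecayingSolution (ptCoeff (μ * √ω) y (1 + 1 / μ) (ω - ν)) u v) {σ : ℂ}
    (hσ : (v 0 : ℂ) = -σ * v 0) (hj : (u 0 : ℂ) - σ * u 0 = -(γ : ℂ) * v 0)
    (hu : MemLp (glue σ u) 2 volume) : hu.toLp _ ∈ eigenspace (L1sym γ μ ω y) ν := by
  obtain ⟨C, κ, hκ, hb⟩ := h.bound
  have hv : MemLp (glue (-σ) v) 2 := memLp_glue _ h.continuous_deriv hκ fun x hx => (hb x hx).2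
  have w1 := hasWeakDeriv_glue σ h.hasDerivAt h.continuous_deriv
  have w2 := hasWeakDeriv_glue (-σ) h.hasDerivAt_deriv
    ((contDiff_ptCoeff _ _ _ _).continuous.mul h.continuous)
  refine mem_eigenspace_L1sym.2 ⟨hv.toLp _, _, ⟨w1.congr hu.coeFn_toLp.symm hv.coeFn_toLp.symm,
    w2.congr hv.coeFn_toLp.symm ?_, u 0, σ * u 0, v 0, ?_, ?_, ?_, ?_, hj⟩, rfl⟩
  · filter_upwards [coeFn_second_deriv (μ := μ) (ω := ω) (y := y) (z := ν) (hu.toLp _),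
      hu.coeFn_toLp, ae_ne_zero] with x h1 h2 hx
    rw [h1, h2, sub_symPotential_eq hμ hω, neg_neg, Complex.real_smul]
    rcases lt_or_gt_of_ne hx with hx | hx
    · rw [glue_of_neg _ _ hx, glue_of_neg _ _ hx, abs_of_neg hx]
      push_cast; ring
    · rw [glue_of_pos _ _ hx, glue_of_pos _ _ hx, abs_of_pos hx]
      push_cast; ring
  · exact Trace.congr (traceRight_glue σ h.continuous) hu.coeFn_toLp.symm
  · exact Trace.congr (traceLeft_glue σ h.continuous) hu.coeFn_toLp.symm
  · exact Trace.congr (traceRight_glue (-σ) h.continuous_deriv) hv.coeFn_toLp.symm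
  · have := Trace.congr (traceLeft_glue (-σ) h.continuous_deriv) hv.coeFn_toLp.symm
    rwa [← hσ] at this

lemma toLp_glue_ne_zero {σ : ℂ} (hpos : ∀ x, 0 ≤ x → 0 < u x) (hu : MemLp (glue σ u) 2 volume) :
    hu.toLp _ ≠ 0 := by
  intro h0
  have h1 := hu.coeFn_toLp
  rw [h0] at h1
  have h2 : ∀ᵐ x : ℝ, glue σ u x = 0 := by
    filter_upwards [h1, Lp.coeFn_zero ℂ 2 (volume : Measure ℝ)] with x hx hz
    rw [← hx, hz, Pi.zero_apply]
  have hev : ∀ᶠ x in 𝓝[>] (0 : ℝ) ⊓ ae volume, False := by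
    filter_upwards [h2.filter_mono inf_le_right,
      mem_inf_of_left (self_mem_nhdsWithin : Set.Ioi (0 : ℝ) ∈ 𝓝[>] 0)] with x hx hx0
    rw [glue_of_pos _ _ hx0, Complex.ofReal_eq_zero] at hx
    exact (hpos x (le_of_lt hx0)).ne' hx
  exact hev.exists.elim fun _ => id

/-- Common to both parities: `σ = 1` for even and `σ = -1` for odd eigenfunctions. The last
hypothesis says that the boundary system has no solutions beyond the line `d = σ c`. -/
lemma eigenspace_eq_span (hμ : 0 < μ) (hω : 0 < ω)
    (h : IsDecayingSolution (ptCoeff (μ * √ω) y (1 + 1 / μ) (ω - ν)) u v)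
    (hpos : ∀ x, 0 ≤ x → 0 < u x) {σ : ℂ}
    (hσ : (v 0 : ℂ) = -σ * v 0) (hj : (u 0 : ℂ) - σ * u 0 = -(γ : ℂ) * v 0)
    (huniq : ∀ c d : ℂ, (v 0 : ℂ) * c = -(v 0 * d) →
      (u 0 : ℂ) * c - u 0 * d = -(γ : ℂ) * (v 0 * c) → d = σ * c) :
    ∃ e : L2R, e ≠ 0 ∧ e =ᵐ[volume] glue σ u ∧
      eigenspace (L1sym γ μ ω y) ν = Submodule.span ℂ {e} := by
  obtain ⟨C, κ, hκ, hb⟩ := h.bound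
  have hu : MemLp (glue σ u) 2 volume := memLp_glue _ h.continuous hκ fun x hx => (hb x hx).1
  refine ⟨hu.toLp _, toLp_glue_ne_zero hpos hu, hu.coeFn_toLp, le_antisymm (fun ψ hψ => ?_) ?_⟩
  · obtain ⟨c, d, hc, hd, h1, h2⟩ := exists_coeff_of_mem_eigenspace hμ hω h hpos hψ
    have hdc := huniq c d h1 h2
    refine Submodule.mem_span_singleton.2 ⟨c, Lp.ext ?_⟩
    filter_upwards [Lp.coeFn_smul c (hu.toLp _), hu.coeFn_toLp, hc, hd, ae_ne_zero]
      with x e1 e2 e3 e4 hx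
    rw [e1, Pi.smul_apply, e2, smul_eq_mul]
    rcases lt_or_gt_of_ne hx with hx | hx
    · rw [glue_of_neg _ _ hx, e4 hx, hdc, Complex.real_smul]
      ring
    · rw [glue_of_pos _ _ hx, e3 hx, Complex.real_smul]
      ring
  · rw [Submodule.span_singleton_le_iff_mem]
    exact toLp_glue_mem_eigenspace hμ hω h hσ hj hu

lemma eigenspace_even (hμ : 0 < μ) (hω : 0 < ω)
    (h : IsDecayingSolution (ptCoeff (μ * √ω) y (1 + 1 / μ) (ω - ν)) u v)
    (hpos : ∀ x, 0 ≤ x → 0 < u x) (hv : v 0 = 0) :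
    ∃ e : L2R, e ≠ 0 ∧ e =ᵐ[volume] glue 1 u ∧
      eigenspace (L1sym γ μ ω y) ν = Submodule.span ℂ {e} := by
  have hu0 : (u 0 : ℂ) ≠ 0 := Complex.ofReal_ne_zero.2 (hpos 0 le_rfl).ne'
  refine eigenspace_eq_span hμ hω h hpos (by simp [hv]) (by simp [hv]) fun c d _ h2 => ?_
  rw [hv] at h2
  refine mul_left_cancel₀ hu0 ?_
  simp only [Complex.ofReal_zero] at h2
  linear_combination -h2

lemma eigenspace_odd (hγ : 0 < γ) (hμ : 0 < μ) (hω : 0 < ω)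
    (h : IsDecayingSolution (ptCoeff (μ * √ω) y (1 + 1 / μ) (ω - ν)) u v)
    (hpos : ∀ x, 0 ≤ x → 0 < u x) (hv : v 0 + 2 / γ * u 0 = 0) :
    ∃ e : L2R, e ≠ 0 ∧ e =ᵐ[volume] glue (-1) u ∧
      eigenspace (L1sym γ μ ω y) ν = Submodule.span ℂ {e} := by
  have hu0 := hpos 0 le_rfl
  have hv0 : v 0 ≠ 0 := by
    intro h0
    rw [h0, zero_add] at hv
    have : 0 < 2 / γ * u 0 := by positivity
    exact this.ne' hv
  have hv0' : (v 0 : ℂ) ≠ 0 := Complex.ofReal_ne_zero.2 hv0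
  have hr : u 0 + u 0 = -γ * v 0 := by
    field_simp at hv
    linarith
  refine eigenspace_eq_span hμ hω h hpos (by simp) ?_ fun c d h1 _ => ?_
  · have : ((u 0 + u 0 : ℝ) : ℂ) = ((-γ * v 0 : ℝ) : ℂ) := by rw [hr]
    push_cast at this
    linear_combination this
  · refine mul_left_cancel₀ hv0' ?_
    linear_combination h1

/-- Continuity of the derivative forces `d = -c`, and the jump condition then reads `(v 0 + 2 / γ *
u 0) c = 0`. -/
lemma eigenspace_eq_bot (hγ : 0 < γ) (hμ : 0 < μ) (hω : 0 < ω)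
    (h : IsDecayingSolution (ptCoeff (μ * √ω) y (1 + 1 / μ) (ω - ν)) u v)
    (hpos : ∀ x, 0 ≤ x → 0 < u x) (hv : v 0 ≠ 0) (hv' : v 0 + 2 / γ * u 0 ≠ 0) :
    eigenspace (L1sym γ μ ω y) ν = ⊥ := by
  rw [Submodule.eq_bot_iff]
  intro ψ hψ
  obtain ⟨c, d, hc, hd, h1, h2⟩ := exists_coeff_of_mem_eigenspace hμ hω h hpos hψ
  have hv0 : (v 0 : ℂ) ≠ 0 := Complex.ofReal_ne_zero.2 hv
  have hdc : d = -c := mul_left_cancel₀ hv0 (by linear_combination h1)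
  have hr : ((v 0 + 2 / γ * u 0 : ℝ) : ℂ) ≠ 0 := Complex.ofReal_ne_zero.2 hv'
  have hγ' : (γ : ℂ) ≠ 0 := Complex.ofReal_ne_zero.2 hγ.ne'
  have hc0 : c = 0 := by
    refine (mul_eq_zero.1 (?_ : ((v 0 + 2 / γ * u 0 : ℝ) : ℂ) * c = 0)).resolve_left hr
    rw [hdc] at h2
    push_cast
    field_simp
    linear_combination h2
  refine Lp.ext ?_
  filter_upwards [hc, hd, ae_ne_zero, Lp.coeFn_zero ℂ 2 (volume : Measure ℝ)] with x e1 e2 hx hz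
  rw [hz, Pi.zero_apply]
  rcases lt_or_gt_of_ne hx with hx | hx
  · rw [e2 hx, hdc, hc0, neg_zero, smul_zero]
  · rw [e1 hx, hc0, smul_zero]

end Eigenspace

/-! ### Negative spectrum and kernel -/

/-- A strictly decreasing logarithmic derivative takes the value `-β` at most once. -/
lemma robin_unique {a y s β κ κ' : ℝ} (ha : 0 < a) (hy : 0 < y) (hs : 1 < s)
    (hκ : a * (s - 1) < κ) (hκ' : a * (s - 1) < κ')
    (h : ptSol' a y s κ 0 + β * ptSol a y s κ 0 = 0)
    (h' : ptSol' a y s κ' 0 + β * ptSol a y s κ' 0 = 0) : κ = κ' := by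
  have key : ∀ {κ κ' : ℝ}, a * (s - 1) < κ → ptSol' a y s κ 0 + β * ptSol a y s κ 0 = 0 →
      ptSol' a y s κ' 0 + β * ptSol a y s κ' 0 = 0 → ¬ κ < κ' := by
    intro κ κ' hκ h h' hlt
    have := ptSol_slope_lt ha hy hs hκ hlt
    rw [eq_neg_of_add_eq_zero_left h, eq_neg_of_add_eq_zero_left h'] at this
    linarith
  exact le_antisymm (not_lt.1 (key hκ' h' h)) (not_lt.1 (key hκ h h'))

lemma finrank_span_eq_one {V : Type*} [AddCommGroup V] [Module ℂ V] {S : Submodule ℂ V} {e : V}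
    (he : e ≠ 0) (hS : S = Submodule.span ℂ {e}) : Module.finrank ℂ S = 1 := by
  rw [hS, finrank_span_singleton he]

/-- The Neumann condition keeps the term `0 * ptSol` so that both parities are Robin conditions,
with `β = 0` and `β = 2 / γ`. -/
lemma eigenspace_L1sym_of_neg {γ μ ω y ν : ℝ} (hγ : 0 < γ) (hμ : 0 < μ) (hω : 0 < ω) (hy : 0 < y)
    {a s κ : ℝ} (ha : a = μ * √ω) (hs : s = 1 + 1 / μ) (hκ : a * (s - 1) < κ)
    (hν : κ ^ 2 = ω - ν) :
    (ptSol' a y s κ 0 + 0 * ptSol a y s κ 0 = 0 ∨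
        ptSol' a y s κ 0 + 2 / γ * ptSol a y s κ 0 = 0 →
      Module.finrank ℂ (eigenspace (L1sym γ μ ω y) ν) = 1) ∧
    (eigenspace (L1sym γ μ ω y) ν ≠ ⊥ ↔ ptSol' a y s κ 0 + 0 * ptSol a y s κ 0 = 0 ∨
        ptSol' a y s κ 0 + 2 / γ * ptSol a y s κ 0 = 0) := by
  have ha0 : 0 < a := by rw [ha]; positivity
  have hs1 : 1 < s := by rw [hs]; linarith [one_div_pos.2 hμ]
  have hκ0 : 0 < κ := (mul_pos ha0 (by linarith)).trans hκ
  have h := isDecayingSolution_ptSol ha0 hy.le (by linarith : 0 ≤ s) hκ0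
  have hpos : ∀ x, 0 ≤ x → 0 < ptSol a y s κ x := fun x hx => ptSol_pos ha0 hy hs1 hκ hx
  rw [hν] at h
  have h1 : ptSol' a y s κ 0 + 0 * ptSol a y s κ 0 = 0 ∨
        ptSol' a y s κ 0 + 2 / γ * ptSol a y s κ 0 = 0 →
      Module.finrank ℂ (eigenspace (L1sym γ μ ω y) ν) = 1 := by
    subst ha hs
    rintro (hv | hv)
    · rw [zero_mul, add_zero] at hv
      obtain ⟨e, he, -, hS⟩ := eigenspace_even (γ := γ) hμ hω h hpos hv
      exact finrank_span_eq_one he hS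
    · obtain ⟨e, he, -, hS⟩ := eigenspace_odd hγ hμ hω h hpos hv
      exact finrank_span_eq_one he hS
  refine ⟨h1, fun hne => ?_, fun hP hbot => ?_⟩
  · by_contra hcon
    rw [not_or, zero_mul, add_zero] at hcon
    subst ha hs
    exact hne (eigenspace_eq_bot hγ hμ hω h hpos hcon.1 hcon.2)
  · have := h1 hP
    rw [hbot, finrank_bot] at this
    exact zero_ne_one this

lemma tanh_symShift {γ μ ω : ℝ} (hμ : 0 < μ) (hω : 0 < ω) (h : 2 < γ * √ω) :
    Real.tanh (μ * √ω * symShift γ μ ω) = 2 / (γ * √ω) := by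
  have hsq := Real.sqrt_pos.2 hω
  have hr : 0 < (γ * √ω + 2) / (γ * √ω - 2) := div_pos (by linarith) (by linarith)
  have hθ : Real.exp (μ * √ω * symShift γ μ ω) ^ 2 = (γ * √ω + 2) / (γ * √ω - 2) := by
    rw [← Real.exp_nat_mul, symShift]
    have : ((2 : ℕ) : ℝ) * (μ * √ω * (1 / (2 * μ * √ω) *
        Real.log ((γ * √ω + 2) / (γ * √ω - 2)))) = Real.log ((γ * √ω + 2) / (γ * √ω - 2)) := by
      push_cast
      field_simp
    rw [this, Real.exp_log hr]
  have he := Real.exp_pos (μ * √ω * symShift γ μ ω)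
  rw [Real.tanh_eq_sinh_div_cosh, Real.sinh_eq, Real.cosh_eq, Real.exp_neg]
  set e := Real.exp (μ * √ω * symShift γ μ ω)
  have h1 : γ * √ω - 2 ≠ 0 := by linarith
  have h2 : γ ≠ 0 := by
    rintro rfl
    linarith
  rw [eq_div_iff h1] at hθ
  field_simp
  linear_combination hθ

lemma symShift_pos {γ μ ω : ℝ} (hμ : 0 < μ) (hω : 0 < ω) (h : 2 < γ * √ω) :
    0 < symShift γ μ ω := by
  have hsq := Real.sqrt_pos.2 hω
  refine mul_pos (by positivity) (Real.log_pos ?_)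
  rw [one_lt_div (by linarith)]
  linarith

/-- The signs of the boundary values of the threshold solution. -/
lemma ptXi_boundary {γ μ ω y a s : ℝ} (hγ : 0 < γ) (hμ : 0 < μ) (hω : omegaZero γ < ω)
    (hy : y = symShift γ μ ω) (ha : a = μ * √ω) (hs : s = 1 + 1 / μ) :
    0 < ω ∧ 0 < y ∧ 0 < ptXi' a y s 0 + 2 / γ * ptXi a y s 0 ∧
      ∃ C, 0 < C ∧ ptXi' a y s 0 = C * (ω - omegaStar γ μ) := by
  have hω0 : 0 < ω := lt_trans (by unfold omegaZero; positivity) hω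
  have hsq := Real.sqrt_pos.2 hω0
  have hsq2 := Real.sq_sqrt hω0.le
  have hγω : 2 < γ * √ω := by
    unfold omegaZero at hω
    rw [div_lt_iff₀ (by positivity)] at hω
    nlinarith [mul_pos hγ hsq]
  have hy0 : 0 < y := hy ▸ symShift_pos hμ hω0 hγω
  have ha0 : 0 < a := by rw [ha]; positivity
  have ht : Real.tanh (a * y) = 2 / (γ * √ω) := by rw [ha, hy, tanh_symShift hμ hω0 hγω]
  have hξ := ptXi_pos (s := s) ha0 hy0 (le_refl 0)
  have hξ' := ptXi'_zero (s := s) ha0 hy0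
  rw [ht] at hξ'
  -- With `t = 2 / (γ√ω)` the logarithmic derivative is `a (1 - s t²) / t`, and `s t² = ω* / ω`.
  have hval : ptXi' a y s 0 =
      a * ptXi a y s 0 * (γ / (2 * √ω)) * (ω - omegaStar γ μ) := by
    have : ptXi' a y s 0 = a * (1 - s * (2 / (γ * √ω)) ^ 2) * ptXi a y s 0 * (γ * √ω / 2) := by
      rw [← hξ']
      field_simp
    rw [this, hs, omegaStar, div_pow, mul_pow, hsq2]
    field_simp
    rw [hsq2]
    ring
  refine ⟨hω0, hy0, ?_, _, by positivity, hval⟩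
  -- Since `a γ / (2√ω) = μγ/2` and `ω* - ω₀ = 4 / (γ² μ)`, adding `2 / γ` replaces `ω*` by `ω₀`.
  have : ptXi' a y s 0 + 2 / γ * ptXi a y s 0 =
      a * ptXi a y s 0 * (γ / (2 * √ω)) * (ω - omegaZero γ) := by
    rw [hval, ha, omegaStar, omegaZero]
    field_simp
    ring
  rw [this]
  have := sub_pos.2 hω
  positivity

/-- The negative eigenvalues, parametrized by the decay rate `κ`, are the solutions of a Neumann or
a Robin condition. -/
lemma mem_negEigenvalues_L1sym {γ μ ω y ν a s : ℝ} (hγ : 0 < γ) (hμ : 0 < μ) (hω : 0 < ω)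
    (hy : 0 < y) (ha : a = μ * √ω) (hs : s = 1 + 1 / μ) :
    ν ∈ negEigenvalues (L1sym γ μ ω y) ↔ ∃ κ, a * (s - 1) < κ ∧ ν = ω - κ ^ 2 ∧
      (ptSol' a y s κ 0 + 0 * ptSol a y s κ 0 = 0 ∨
        ptSol' a y s κ 0 + 2 / γ * ptSol a y s κ 0 = 0) := by
  have has : a * (s - 1) = √ω := by rw [ha, hs]; field_simp; ring
  have hsq := Real.sqrt_pos.2 hω
  constructor
  · rintro ⟨hν, hne⟩
    have hκ2 : √(ω - ν) ^ 2 = ω - ν := Real.sq_sqrt (by linarith)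
    have hκ : a * (s - 1) < √(ω - ν) := by
      rw [has]; exact Real.sqrt_lt_sqrt hω.le (by linarith)
    exact ⟨√(ω - ν), hκ, by rw [hκ2]; ring,
      (eigenspace_L1sym_of_neg hγ hμ hω hy ha hs hκ hκ2).2.1 hne⟩
  · rintro ⟨κ, hκ, rfl, hP⟩
    refine ⟨?_, (eigenspace_L1sym_of_neg hγ hμ hω hy ha hs hκ (by ring)).2.2 hP⟩
    rw [has] at hκ
    have := Real.sq_sqrt hω.le
    nlinarith

lemma glue_one_ptXi {μ ω y x : ℝ} (hx : x ≠ 0) :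
    glue 1 (ptXi (μ * √ω) y (1 + 1 / μ)) x = (xiMinusOne μ ω y x : ℂ) := by
  have e : xiMinusOne μ ω y x = ptXi (μ * √ω) y (1 + 1 / μ) |x| := by
    rw [xiMinusOne, ptXi, Real.rpow_neg (Real.cosh_pos _).le, div_eq_mul_inv]
  rw [e]
  rcases lt_or_gt_of_ne hx with hx | hx
  · rw [glue_of_neg _ _ hx, one_mul, abs_of_neg hx]
  · rw [glue_of_pos _ _ hx, abs_of_pos hx]

end DeltaPrime

end

open DeltaPrime in
theorem proposition6p3 (γ μ ω y : ℝ) (hγ : 0 < γ) (hμ : 0 < μ) (hω : omegaZero γ < ω)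
    (hy : y = symShift γ μ ω) :
    (ω < omegaStar γ μ →
      kernel (L1sym γ μ ω y) = ⊥ ∧
      ∃ ν : ℝ, negEigenvalues (L1sym γ μ ω y) = {ν} ∧
        Module.finrank ℂ (eigenspace (L1sym γ μ ω y) ν) = 1) ∧
    (ω = omegaStar γ μ →
      (∃ ξ : L2R, (∀ᵐ x : ℝ, ξ x = (xiMinusOne μ ω y x : ℂ)) ∧
        kernel (L1sym γ μ ω y) = Submodule.span ℂ {ξ}) ∧
      Module.finrank ℂ (kernel (L1sym γ μ ω y)) = 1 ∧
      ∃ ν : ℝ, negEigenvalues (L1sym γ μ ω y) = {ν} ∧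
        Module.finrank ℂ (eigenspace (L1sym γ μ ω y) ν) = 1) ∧
    (omegaStar γ μ < ω →
      kernel (L1sym γ μ ω y) = ⊥ ∧
      ((∃ ν₁ ν₂ : ℝ, ν₁ ≠ ν₂ ∧ negEigenvalues (L1sym γ μ ω y) = {ν₁, ν₂} ∧
          Module.finrank ℂ (eigenspace (L1sym γ μ ω y) ν₁) = 1 ∧
          Module.finrank ℂ (eigenspace (L1sym γ μ ω y) ν₂) = 1) ∨
        (∃ ν : ℝ, negEigenvalues (L1sym γ μ ω y) = {ν} ∧
          Module.finrank ℂ (eigenspace (L1sym γ μ ω y) ν) = 2))) := by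
  obtain ⟨a, ha⟩ : ∃ a, a = μ * √ω := ⟨_, rfl⟩
  obtain ⟨s, hs⟩ : ∃ s, s = 1 + 1 / μ := ⟨_, rfl⟩
  obtain ⟨hω0, hy0, hodd, C, hC, heven⟩ := ptXi_boundary hγ hμ hω hy ha hs
  have ha0 : 0 < a := by rw [ha]; have := Real.sqrt_pos.2 hω0; positivity
  have hs1 : 1 < s := by rw [hs]; linarith [one_div_pos.2 hμ]
  have hE : (a * (s - 1)) ^ 2 = ω - 0 := by
    have e : μ * √ω * (1 + 1 / μ - 1) = √ω := by
      field_simp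
      ring
    rw [ha, hs, e, Real.sq_sqrt hω0.le, sub_zero]
  have hξ := isDecayingSolution_ptXi (y := y) ha0 hs1
  rw [hE] at hξ
  have hξpos : ∀ x, 0 ≤ x → 0 < ptXi a y s x := fun x hx => ptXi_pos ha0 hy0 hx
  have hker : kernel (L1sym γ μ ω y) = eigenspace (L1sym γ μ ω y) (0 : ℝ) := by
    rw [kernel_eq_eigenspace, Complex.ofReal_zero]
  have hkerbot : ω ≠ omegaStar γ μ → kernel (L1sym γ μ ω y) = ⊥ := fun hne => by
    have h0 : ptXi' a y s 0 ≠ 0 := by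
      rw [heven]; exact mul_ne_zero hC.ne' (sub_ne_zero.2 hne)
    rw [hker]
    subst ha hs
    exact eigenspace_eq_bot hγ hμ hω0 hξ hξpos h0 hodd.ne'
  obtain ⟨κ, hκ, hκr⟩ := exists_robin (β := 2 / γ) ha0 hy0 hs1 (by positivity) hodd
  have hmem := fun ν => mem_negEigenvalues_L1sym (ν := ν) hγ hμ hω0 hy0 ha hs
  have hrank : ∀ κ, a * (s - 1) < κ → (ptSol' a y s κ 0 + 0 * ptSol a y s κ 0 = 0 ∨
      ptSol' a y s κ 0 + 2 / γ * ptSol a y s κ 0 = 0) →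
      Module.finrank ℂ (eigenspace (L1sym γ μ ω y) (ω - κ ^ 2 : ℝ)) = 1 := fun κ hκ hP =>
    (eigenspace_L1sym_of_neg hγ hμ hω0 hy0 ha hs hκ (by ring)).1 hP
  have hone : ω ≤ omegaStar γ μ → ∃ ν : ℝ, negEigenvalues (L1sym γ μ ω y) = {ν} ∧
      Module.finrank ℂ (eigenspace (L1sym γ μ ω y) ν) = 1 := fun hle => by
    refine ⟨ω - κ ^ 2, ?_, hrank κ hκ (Or.inr hκr)⟩
    ext ν
    rw [hmem, Set.mem_singleton_iff]
    constructor
    · rintro ⟨κ', hκ', rfl, h | h⟩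
      -- An even eigenfunction below the threshold would make `ptXi'` positive at `0`, against `ω ≤
      -- ω*`.
      · have h1 := ptSol_slope_lt_ptXi ha0 hy0 hs1 hκ'
        rw [zero_mul, add_zero] at h
        rw [h, zero_mul, heven] at h1
        have h2 := ptSol_pos (s := s) ha0 hy0 hs1 hκ' le_rfl
        have h3 : C * (ω - omegaStar γ μ) ≤ 0 := mul_nonpos_of_nonneg_of_nonpos hC.le (by linarith)
        exact absurd h1 (mul_nonpos_of_nonneg_of_nonpos h2.le h3).not_gt
      · rw [robin_unique ha0 hy0 hs1 hκ hκ' hκr h]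
    · rintro rfl
      exact ⟨κ, hκ, rfl, Or.inr hκr⟩
  -- In case c) the alternative of two distinct simple eigenvalues always holds, one odd and one
  -- even.
  refine ⟨fun h => ⟨hkerbot h.ne, hone h.le⟩, fun h => ?_, fun h => ⟨hkerbot h.ne', Or.inl ?_⟩⟩
  · have h0 : ptXi' a y s 0 = 0 := by rw [heven, h, sub_self, mul_zero]
    obtain ⟨e, he, hae, hspan⟩ : ∃ e : L2R, e ≠ 0 ∧ e =ᵐ[volume] glue 1 (ptXi a y s) ∧
        eigenspace (L1sym γ μ ω y) (0 : ℝ) = Submodule.span ℂ {e} := by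
      clear hmem hrank
      subst ha hs
      exact eigenspace_even hμ hω0 hξ hξpos h0
    rw [← hker] at hspan
    refine ⟨⟨e, ?_, hspan⟩, finrank_span_eq_one he hspan, hone h.le⟩
    filter_upwards [hae, ae_ne_zero] with x hx hx0
    rw [hx, ha, hs, glue_one_ptXi hx0]
  · obtain ⟨κ', hκ', hκr'⟩ := exists_robin (β := 0) ha0 hy0 hs1 le_rfl (by
      rw [zero_mul, add_zero, heven]
      exact mul_pos hC (sub_pos.2 h))
    have hpos : 0 < a * (s - 1) := mul_pos ha0 (by linarith)
    refine ⟨ω - κ ^ 2, ω - κ' ^ 2, fun heq => ?_, ?_, hrank κ hκ (Or.inr hκr),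
      hrank κ' hκ' (Or.inl hκr')⟩
    -- If the two eigenvalues coincided, one solution would satisfy both the Neumann and the Robin
    -- condition, and its value at `0` would vanish.
    · have hκκ' : κ = κ' := by
        have : κ ^ 2 = κ' ^ 2 := by linarith
        exact (sq_eq_sq₀ (hpos.trans hκ).le (hpos.trans hκ').le).1 this
      rw [← hκκ'] at hκr'
      have h2 := ptSol_pos (s := s) ha0 hy0 hs1 hκ le_rfl
      have h3 : 0 < 2 / γ * ptSol a y s κ 0 := by positivity
      linarith
    · ext ν
      rw [hmem, Set.mem_insert_iff, Set.mem_singleton_iff]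
      constructor
      · rintro ⟨k, hk, rfl, h | h⟩
        · rw [robin_unique ha0 hy0 hs1 hκ' hk hκr' h]
          exact Or.inr rfl
        · rw [robin_unique ha0 hy0 hs1 hκ hk hκr h]
          exact Or.inl rfl
      · rintro (rfl | rfl)
        · exact ⟨κ, hκ, rfl, Or.inr hκr⟩
        · exact ⟨κ', hκ', rfl, Or.inl hκr'⟩
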